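/- **Setting.** Inner products are antilinear in the first argument. *Operator.* Let $H$ be a separable complex Hilbert space and $A$ a bounded operator on $H$ with $A^*A=AA^*=r_AI$ for a real $r_A>0$. Let $\phi\in H$, $\|\phi\|=1$, be cyclic, i.e. $\{P(A,A^*)\phi : P\in\mathbb C[X,Y]\}$ is dense in $H$. For $P\in\mathbb C[X,Y]$ write $f_P(\lambda)=P(\lambda,\overline\lambda)$. *Approximations.* For $N\in\mathbb N=\{0,1,2,\dots\}$ let $H_N$ be the span of the vectors $A^i(A^*)^j\phi$ with $i,j\le N$, let $H_N^-$ be the span of those with $i<N$, $j\le N$, and $H_N^+$ the span of those with $0<i\le N$, $j\le N$. Let $W_N^\pm$ be the orthogonal complement of $H_N^\pm$ in $H_N$. Choose a unitary $U_N:W_N^-\to W_N^+$ and let $A_N$ be the operator on $H_N$ that is $A$ on $H_N^-$ and $\sqrt{r_A}\,U_N$ on $W_N^-$. Choose an orthonormal basis $u_N(n)$, $n<D_N=\dim H_N$, of $H_N$ consisting of eigenvectors of $A_N$, with eigenvalues $\lambda_N(n)$, such that $\xi_N(n)=\langle u_N(n)|\phi\rangle$ is real and $\ge 0$. *Metric ultraproduct.*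 Let $D$ be an ultrafilter on $\mathbb N$ that for every $m\ge1$ contains $\{N\ge 1:\sqrt N\in\mathbb N,\ m\mid\sqrt N\}$. Let $H^m$ be the metric ultraproduct of the $H_N$: sequences $(v_N)$ that are norm-bounded on a set of indices in $D$, modulo $\lim_D\|v_N-w_N\|=0$; write $[v]_2$ for the class of $v$, and $\langle[v]_2|[w]_2\rangle=\lim_D\langle v_N|w_N\rangle$. Let $G^m:H\to H^m$ be the isometric embedding determined by mapping $\psi=P(A,A^*)\phi$ to the class of the sequence with value $\psi$ for all large $N$. *Spectral measure.* Let $M$ be a natural number with $M>\|A\|$ and $M>\sqrt{r_A}$, and $S=\{\lambda\in\mathbb C:|\mathrm{Re}\,\lambda|\le M,\ |\mathrm{Im}\,\lambda|\le M\}$. For $X\subseteq\mathbb C$ let $\mu_N(X)=\sum_{\lambda_N(n)\in X}\xi_N(n)^2$ and $\mu^n(X)=\lim_D\mu_N(X)$. For $t\in\mathbb R$ and $\varepsilon>0$ let $I_t^\varepsilon=\{\lambda\in S:|\mathrm{Re}\,\lambda-t|<\varepsilon\}$ and $J_t^\varepsilon=\{\lambda\in S:|\mathrm{Im}\,\lambda-t|<\varepsilon\}$.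 Fix a countable dense set $NI\subseteq[-M,M]$ that contains $\pm M$ and such that for each $t\in NI$ and each $\delta>0$ there is $\varepsilon>0$ with $\mu^n(I_t^\varepsilon),\mu^n(J_t^\varepsilon)<\delta$. Let $Sq^*$ be the set of all open rectangles $\{\lambda\in S: a<\mathrm{Re}\,\lambda<b,\ c<\mathrm{Im}\,\lambda<d\}$ with $a,b,c,d\in NI$. Let $\mu$ be the Borel measure given by the outer measure $\mu^*(Y)=\inf\{\sum_{i}\mu^n(X_i): X_i\in Sq^*,\ Y\cap\mathrm{Int}(S)\subseteq\bigcup_{i\in\mathbb N} X_i\}$. *Kernel.* Let $B$ be a linear operator on $H$ and $B_D$ the operator on $L_2(\sigma(A),\mu\restriction\sigma(A))$ corresponding to $B$ under the unitary $L_2(\sigma(A),\mu\restriction\sigma(A))\to H$ determined by $f_P\mapsto P(A,A^*)\phi$. Suppose $K:\sigma(A)^2\to\mathbb C$ is continuous and for every $P\in\mathbb C[X,Y]$ the class $B_D(f_P)$ contains a continuous function $g$ with $g(y)=\int_{\sigma(A)}K(x,y)f_P(x)\,d\mu(x)$ for all $y\in\sigma(A)$. *Grids.* Let $\alpha,\beta\in\sigma(A)$.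 Let $r^n_i\in[-M,M]$ ($n\in\mathbb N$, $0\le i\le2^{n+2}$) satisfy: $r^n_i<r^n_{i+1}$ and $r^n_{i+1}-r^n_i<2M/(n+1)$ for $i<2^{n+2}$; $r^0_0=-M$ and $r^0_4=M$; every $r^n_i$ equals some $r^{n+1}_j$; no $r^n_i$ is the real or the imaginary part of $\alpha$ or $\beta$; and for all $n$ and $\delta>0$ there is $\varepsilon>0$ with $\mu^n\big(\bigcup_i(I^\varepsilon_{r^n_i}\cup J^\varepsilon_{r^n_i})\big)<\delta$. For $p\in\mathbb N$ let $B^p_\alpha$ be the box $\{\lambda\in S:r^p_i<\mathrm{Re}\,\lambda<r^p_{i+1},\ r^p_j<\mathrm{Im}\,\lambda<r^p_{j+1}\}$, $i,j<2^{p+2}$, that contains $\alpha$, let $$u^p_\alpha(N)=\sum_{\lambda_N(k)\in B^p_\alpha}\frac{\xi_N(k)}{\mu_N(B^p_\alpha)}\,u_N(k),\qquad u^p_\alpha=(u^p_\alpha(N))_{N\in\mathbb N}$$ (with value $0$ when $\mu_N(B^p_\alpha)=0$), and define $B^p_\beta$ and $u^p_\beta$ likewise. **Theorem 5.2.** In this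 setting let $B_N$, $N\in\mathbb N$, be linear operators on $H_N$ such that (C1) there is a natural number $K_D$ with $\|B_N(v)\|\le K_D\|v\|$ for all $N$ and all $v\in H_N$, so that $B^m([(v_N)]_2)=[(B_N(v_N))]_2$ defines a bounded operator $B^m$ on $H^m$; (C2) $B^m(G^m(\psi))=G^m(B(\psi))$ for all $\psi\in H$. Then for every $p$ the sequences $u^p_\alpha$ and $u^p_\beta$ represent elements of $H^m$, and $$K(\alpha,\beta)=\lim_{p\to\infty}\big\langle[u^p_\beta]_2\,\big|\,B^m([u^p_\alpha]_2)\big\rangle .$$ -/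

import Mathlib

open Filter Topology MeasureTheory

namespace KernelLimit

/-! ## Metric ultraproducts of inner product spaces along an ultrafilter on the natural numbers -/

section Ultraproduct

universe u

variable (D : Ultrafilter ℕ) (E : ℕ → Type u)
  [∀ N, NormedAddCommGroup (E N)] [∀ N, InnerProductSpace ℂ (E N)]

/-- Sequences `(v_N)` whose norms are bounded on a set of indices belonging to `D`
(that is, sequences representing an element of finite norm in the ultraproduct). -/
def bddSubmodule : Submodule ℂ (∀ N, E N) where
  carrier := {v | ∃ C : ℝ, ∀ᶠ N in (D : Filter ℕ), ‖v N‖ ≤ C}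
  zero_mem' := ⟨0, by simp⟩
  add_mem' := by
    rintro v w ⟨a, ha⟩ ⟨b, hb⟩
    refine ⟨a + b, ?_⟩
    filter_upwards [ha, hb] with N h1 h2
    exact (norm_add_le _ _).trans (add_le_add h1 h2)
  smul_mem' := by
    rintro c v ⟨a, ha⟩
    refine ⟨‖c‖ * a, ?_⟩
    filter_upwards [ha] with N h1
    simp only [Pi.smul_apply, norm_smul]
    gcongr

/-- The space of `D`-bounded sequences, as a type of its own, so that it only carries the
seminorm `lim_D ‖v_N‖`, and not the product topology. -/
def BddSeq : Type u := bddSubmodule D E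

noncomputable instance : AddCommGroup (BddSeq D E) := inferInstanceAs (AddCommGroup (bddSubmodule D E))

noncomputable instance : Module ℂ (BddSeq D E) := inferInstanceAs (Module ℂ (bddSubmodule D E))

variable {D E}

theorem tendsto_limUnder_of_bdd {F : Type*} [NormedAddCommGroup F] [ProperSpace F]
    {f : ℕ → F} {C : ℝ} (h : ∀ᶠ N in (D : Filter ℕ), ‖f N‖ ≤ C) :
    Tendsto f D (𝓝 (limUnder (D : Filter ℕ) f)) := by
  have hk : IsCompact (Metric.closedBall (0 : F) C) := isCompact_closedBall 0 C
  obtain ⟨x, -, hx⟩ := hk.ultrafilter_le_nhds (D.map f) (by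
    rw [le_principal_iff]
    change f ⁻¹' Metric.closedBall 0 C ∈ (D : Filter ℕ)
    filter_upwards [h] with N hN
    simpa using hN)
  exact tendsto_nhds_limUnder ⟨x, hx⟩

theorem tendsto_inner (v w : BddSeq D E) :
    Tendsto (fun N => inner ℂ (v.1 N) (w.1 N)) D
      (𝓝 (limUnder (D : Filter ℕ) fun N => inner ℂ (v.1 N) (w.1 N))) := by
  obtain ⟨a, ha⟩ := v.2
  obtain ⟨b, hb⟩ := w.2
  refine tendsto_limUnder_of_bdd (C := a * b) ?_
  filter_upwards [ha, hb] with N h1 h2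
  exact (norm_inner_le_norm _ _).trans
    (mul_le_mul h1 h2 (norm_nonneg _) ((norm_nonneg _).trans h1))

/-- The semi-inner product `⟨v|w⟩ = lim_D ⟨v_N|w_N⟩` (antilinear in the first argument). -/
@[reducible] noncomputable def bddCore : PreInnerProductSpace.Core ℂ (BddSeq D E) where
  inner v w := limUnder (D : Filter ℕ) fun N => inner ℂ (v.1 N) (w.1 N)
  conj_inner_symm v w := by
    have h := (Complex.continuous_conj.tendsto _).comp (tendsto_inner w v)
    refine tendsto_nhds_unique h ((tendsto_inner v w).congr fun N => ?_)
    simp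
  re_inner_nonneg v := by
    have h := (Complex.continuous_re.tendsto _).comp (tendsto_inner v v)
    refine ge_of_tendsto' h fun N => ?_
    exact inner_self_nonneg (𝕜 := ℂ)
  add_left u v w := by
    refine tendsto_nhds_unique (tendsto_inner (u + v) w)
      (((tendsto_inner u w).add (tendsto_inner v w)).congr fun N => ?_)
    exact (inner_add_left _ _ _).symm
  smul_left u w r := by
    refine tendsto_nhds_unique (tendsto_inner (r • u) w)
      (((tendsto_inner u w).const_mul _).congr fun N => ?_)
    exact (inner_smul_left _ _ _).symm

noncomputable instance : SeminormedAddCommGroup (BddSeq D E) :=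
  @InnerProductSpace.Core.toSeminormedAddCommGroup ℂ (BddSeq D E) _ _ _ bddCore

noncomputable instance : InnerProductSpace ℂ (BddSeq D E) := InnerProductSpace.ofCore bddCore

variable (D E)

/-- The metric ultraproduct: `D`-bounded sequences modulo `v ∼ w ↔ lim_D ‖v_N - w_N‖ = 0`,
with the inner product `⟨[v]|[w]⟩ = lim_D ⟨v_N|w_N⟩`. -/
abbrev MetricUltraproduct : Type u := SeparationQuotient (BddSeq D E)

variable {D E}

/-- The class `[(v_N)]₂` in the metric ultraproduct of a `D`-bounded sequence. -/
noncomputable def cls (v : ∀ N, E N) (hv : v ∈ bddSubmodule D E) : MetricUltraproduct D E :=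
  SeparationQuotient.mkCLM ℂ (BddSeq D E) (⟨v, hv⟩ : bddSubmodule D E)

theorem inner_cls (v w : ∀ N, E N) (hv : v ∈ bddSubmodule D E) (hw : w ∈ bddSubmodule D E) :
    Tendsto (fun N => inner ℂ (v N) (w N)) D (𝓝 (inner ℂ (cls v hv) (cls w hw))) :=
  tendsto_inner (D := D) (E := E) ⟨v, hv⟩ ⟨w, hw⟩

theorem norm_cls (v : ∀ N, E N) (hv : v ∈ bddSubmodule D E) :
    Tendsto (fun N => ‖v N‖) D (𝓝 ‖cls v hv‖) := by
  have h := (Complex.continuous_re.tendsto _).comp (inner_cls v v hv hv)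
  have h2 := (Real.continuous_sqrt.tendsto _).comp h
  have e : ‖cls v hv‖ = √(inner ℂ (cls v hv) (cls v hv)).re :=
    norm_eq_sqrt_re_inner (𝕜 := ℂ) (cls v hv)
  rw [e]
  refine h2.congr fun N => ?_
  exact (norm_eq_sqrt_re_inner (𝕜 := ℂ) (v N)).symm

/-- Two bounded sequences have the same class iff their distance is infinitesimal. -/
theorem cls_eq_iff (v w : ∀ N, E N) (hv : v ∈ bddSubmodule D E) (hw : w ∈ bddSubmodule D E) :
    cls v hv = cls w hw ↔ Tendsto (fun N => ‖v N - w N‖) D (𝓝 0) := by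
  have hs := sub_mem hv hw
  have e : cls v hv - cls w hw = cls (v - w) hs :=
    ((SeparationQuotient.mkCLM ℂ (BddSeq D E)).map_sub _ _).symm
  have h := norm_cls (v - w) hs
  rw [← e] at h
  rw [← sub_eq_zero, ← norm_eq_zero]
  constructor
  · intro h0
    rwa [h0] at h
  · intro h0
    exact tendsto_nhds_unique h h0

theorem map_mem_bdd {B : ∀ N, E N →ₗ[ℂ] E N}
    (hB : ∃ K : ℕ, ∀ N (v : E N), ‖B N v‖ ≤ K * ‖v‖) {v : ∀ N, E N}
    (hv : v ∈ bddSubmodule D E) : (fun N => B N (v N)) ∈ bddSubmodule D E := by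
  obtain ⟨K, hK⟩ := hB
  obtain ⟨C, hC⟩ := hv
  refine ⟨K * C, ?_⟩
  filter_upwards [hC] with N hN
  exact (hK N _).trans (by gcongr)

/-- The operator on `D`-bounded sequences given by a uniformly bounded sequence of operators. -/
noncomputable def seqOp (B : ∀ N, E N →ₗ[ℂ] E N)
    (hB : ∃ K : ℕ, ∀ N (v : E N), ‖B N v‖ ≤ K * ‖v‖) : BddSeq D E →L[ℂ] BddSeq D E :=
  LinearMap.mkContinuousOfExistsBound
    ({ toFun := fun v => (⟨fun N => B N (v.1 N), map_mem_bdd hB v.2⟩ : bddSubmodule D E)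
       map_add' := fun v w => Subtype.ext (funext fun N => (B N).map_add _ _)
       map_smul' := fun c v => Subtype.ext (funext fun N => (B N).map_smul _ _) } :
      BddSeq D E →ₗ[ℂ] BddSeq D E)
    (by
      have hB' := hB
      obtain ⟨K, hK⟩ := hB'
      refine ⟨K, fun v => ?_⟩
      have h1 := norm_cls (D := D) v.1 v.2
      have h2 := norm_cls (D := D) (fun N => B N (v.1 N)) (map_mem_bdd hB v.2)
      exact le_of_tendsto_of_tendsto' h2 (h1.const_mul (K : ℝ)) fun N => hK N _)

/-- The metric ultraproduct of a uniformly bounded sequence of operators: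
`[(v_N)]₂ ↦ [(B_N v_N)]₂`. -/
noncomputable def ultraOp (B : ∀ N, E N →ₗ[ℂ] E N)
    (hB : ∃ K : ℕ, ∀ N (v : E N), ‖B N v‖ ≤ K * ‖v‖) :
    MetricUltraproduct D E →L[ℂ] MetricUltraproduct D E :=
  SeparationQuotient.liftCLM ((SeparationQuotient.mkCLM ℂ (BddSeq D E)).comp (seqOp B hB))
    fun _ _ h => SeparationQuotient.mk_eq_mk.2 (h.map (seqOp B hB).continuous)

theorem ultraOp_cls (B : ∀ N, E N →ₗ[ℂ] E N)
    (hB : ∃ K : ℕ, ∀ N (v : E N), ‖B N v‖ ≤ K * ‖v‖) (v : ∀ N, E N)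
    (hv : v ∈ bddSubmodule D E) :
    ultraOp B hB (cls v hv) = cls (fun N => B N (v N)) (map_mem_bdd hB hv) := rfl

end Ultraproduct

/-! ## The operator, its cyclic vector and the finite-dimensional approximations -/

section Operator

variable {H : Type*} [NormedAddCommGroup H] [InnerProductSpace ℂ H] [CompleteSpace H]

/-- The operator `P(A, A*)` for `P ∈ ℂ[X, Y]`, where `X` and `Y` are the variables `0` and `1`. -/
noncomputable def polyOp (A : H →L[ℂ] H) (P : MvPolynomial (Fin 2) ℂ) : H →L[ℂ] H :=
  ∑ m ∈ P.support, P.coeff m • (A ^ m 0 * star A ^ m 1)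

/-- The function `f_P(z) = P(z, conj z)`. -/
noncomputable def polyFun (P : MvPolynomial (Fin 2) ℂ) (z : ℂ) : ℂ :=
  MvPolynomial.eval ![z, (starRingEnd ℂ) z] P

/-- `φ` is cyclic for `A`: the vectors `P(A, A*) φ` are dense. -/
def IsCyclicVector (A : H →L[ℂ] H) (φ : H) : Prop :=
  Dense (Set.range fun P : MvPolynomial (Fin 2) ℂ => polyOp A P φ)

/-- `H_N`, the span of `A^i (A*)^j φ`, `i ≤ N`, `j ≤ N`. -/
def subN (A : H →L[ℂ] H) (φ : H) (N : ℕ) : Submodule ℂ H :=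
  Submodule.span ℂ {x | ∃ i j : ℕ, i ≤ N ∧ j ≤ N ∧ x = (A ^ i * star A ^ j) φ}

/-- `H_N⁻`, the span of `A^i (A*)^j φ`, `i < N`, `j ≤ N`. -/
def subMinus (A : H →L[ℂ] H) (φ : H) (N : ℕ) : Submodule ℂ H :=
  Submodule.span ℂ {x | ∃ i j : ℕ, i < N ∧ j ≤ N ∧ x = (A ^ i * star A ^ j) φ}

/-- `H_N⁺`, the span of `A^i (A*)^j φ`, `0 < i ≤ N`, `j ≤ N`. -/
def subPlus (A : H →L[ℂ] H) (φ : H) (N : ℕ) : Submodule ℂ H :=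
  Submodule.span ℂ {x | ∃ i j : ℕ, 0 < i ∧ i ≤ N ∧ j ≤ N ∧ x = (A ^ i * star A ^ j) φ}

/-- `W⁻`, the orthogonal complement of `H_N⁻` in `H_N`. -/
noncomputable def compMinus (A : H →L[ℂ] H) (φ : H) (N : ℕ) : Submodule ℂ H := (subMinus A φ N)ᗮ ⊓ subN A φ N

/-- `W⁺`, the orthogonal complement of `H_N⁺` in `H_N`. -/
noncomputable def compPlus (A : H →L[ℂ] H) (φ : H) (N : ℕ) : Submodule ℂ H := (subPlus A φ N)ᗮ ⊓ subN A φ N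

variable (A : H →L[ℂ] H) (φ : H) (N : ℕ)

theorem subMinus_le : subMinus A φ N ≤ subN A φ N :=
  Submodule.span_mono fun _ ⟨i, j, hi, hj, h⟩ => ⟨i, j, hi.le, hj, h⟩

instance : FiniteDimensional ℂ (subN A φ N) := by
  have hf : {x | ∃ i j : ℕ, i ≤ N ∧ j ≤ N ∧ x = (A ^ i * star A ^ j) φ}.Finite := by
    refine (((Set.finite_Iic N).prod (Set.finite_Iic N)).image
      fun p : ℕ × ℕ => (A ^ p.1 * star A ^ p.2) φ).subset ?_
    rintro x ⟨i, j, hi, hj, rfl⟩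
    exact ⟨(i, j), ⟨hi, hj⟩, rfl⟩
  exact FiniteDimensional.span_of_finite ℂ hf

instance : FiniteDimensional ℂ (subMinus A φ N) :=
  Submodule.finiteDimensional_of_le (subMinus_le A φ N)

instance : FiniteDimensional ℂ (compMinus A φ N) :=
  Submodule.finiteDimensional_of_le (S₂ := subN A φ N) inf_le_right

theorem map_subMinus {v : H} (hv : v ∈ subMinus A φ N) : A v ∈ subN A φ N := by
  have h : subMinus A φ N ≤ (subN A φ N).comap (A : H →ₗ[ℂ] H) := by
    refine Submodule.span_le.2 ?_
    rintro x ⟨i, j, hi, hj, rfl⟩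
    refine Submodule.subset_span ⟨i + 1, j, hi, hj, ?_⟩
    simp [pow_succ', mul_assoc]
  exact h hv

variable {A φ N} in
/-- `A_N : H_N → H_N`, which is `A` on `H_N⁻` and `√r • U` on `W⁻`, where `U` is a unitary operator
from `W⁻` onto `W⁺`. -/
noncomputable def approxOp (r : ℝ) (U : compMinus A φ N ≃ₗᵢ[ℂ] compPlus A φ N) :
    subN A φ N →ₗ[ℂ] subN A φ N :=
  LinearMap.codRestrict (subN A φ N)
    (((A ∘L (subMinus A φ N).starProjection : H →L[ℂ] H) : H →ₗ[ℂ] H) ∘ₗ (subN A φ N).subtype +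
      ((√r : ℝ) : ℂ) • ((compPlus A φ N).subtype ∘ₗ U.toLinearEquiv.toLinearMap ∘ₗ
        ((compMinus A φ N).orthogonalProjectionOnto : H →ₗ[ℂ] compMinus A φ N) ∘ₗ
          (subN A φ N).subtype))
    (fun _ => (subN A φ N).add_mem (map_subMinus A φ N (Submodule.starProjection_apply_mem _ _))
      ((subN A φ N).smul_mem _ (Submodule.mem_inf.1 (U _).2).2))

variable {A φ N} in
theorem approxOp_minus (r : ℝ) (U : compMinus A φ N ≃ₗᵢ[ℂ] compPlus A φ N) (v : subN A φ N)
    (hv : (v : H) ∈ subMinus A φ N) : (approxOp r U v : H) = A v := by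
  have h0 : (compMinus A φ N).orthogonalProjectionOnto (v : H) = 0 := by
    rw [Submodule.orthogonalProjectionOnto_eq_zero_iff]
    exact fun w hw => (Submodule.mem_orthogonal' _ _).1 (Submodule.mem_inf.1 hw).1 _ hv
  have h1 : (subMinus A φ N).starProjection (v : H) = v :=
    Submodule.starProjection_eq_self_iff.2 hv
  simp [approxOp, h0, h1]

variable {A φ N} in
theorem approxOp_comp (r : ℝ) (U : compMinus A φ N ≃ₗᵢ[ℂ] compPlus A φ N) (w : compMinus A φ N) :
    (approxOp r U ⟨w, (Submodule.mem_inf.1 w.2).2⟩ : H) = ((√r : ℝ) : ℂ) • (U w : H) := by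
  have h1 : (subMinus A φ N).starProjection (w : H) = 0 := by
    rw [Submodule.starProjection_apply_eq_zero_iff]
    exact (Submodule.mem_inf.1 w.2).1
  simp [approxOp, h1]

/-- The choices made in the construction, for every `N`: the unitary operator `U : W⁻ → W⁺` which
determines `A_N`, and an orthonormal basis `u_N(n)`, `n < D_N = dim H_N`, of `H_N` that consists of
eigenvectors of `A_N`, with eigenvalues `lam N n`, such that `ξ_N(n) = ⟨u_N(n)|φ⟩` is a non-negative
real number. -/
structure EigenSystem (A : H →L[ℂ] H) (φ : H) (r : ℝ) where
  U : ∀ N, compMinus A φ N ≃ₗᵢ[ℂ] compPlus A φ N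
  u : ∀ N, OrthonormalBasis (Fin (Module.finrank ℂ (subN A φ N))) ℂ (subN A φ N)
  lam : ∀ N, Fin (Module.finrank ℂ (subN A φ N)) → ℂ
  eigen : ∀ N n, approxOp r (U N) (u N n) = lam N n • u N n
  xi : ∀ N, Fin (Module.finrank ℂ (subN A φ N)) → ℝ
  xi_nonneg : ∀ N n, 0 ≤ xi N n
  inner_eq_xi : ∀ N n, inner ℂ (u N n : H) φ = (xi N n : ℂ)

/-- The sequence of the orthogonal projections of `ψ` to the spaces `H_N`. -/
noncomputable def projSeq (ψ : H) : ∀ N, subN A φ N :=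
  fun N => (subN A φ N).orthogonalProjectionOnto ψ

theorem projSeq_bdd (D : Ultrafilter ℕ) (ψ : H) :
    projSeq A φ ψ ∈ bddSubmodule D fun N => subN A φ N :=
  ⟨‖ψ‖, Eventually.of_forall fun _ => Submodule.norm_orthogonalProjectionOnto_apply_le _ _⟩

/-- The embedding `G^m` of `H` into the metric ultraproduct of the spaces `H_N`. It is the
continuous map which sends `P(A, A*) φ` to the class of the sequence that is eventually constantly
`P(A, A*) φ`; see `embedding_of_eventually_eq`. -/
noncomputable def embedding (D : Ultrafilter ℕ) :
    H →L[ℂ] MetricUltraproduct D fun N => subN A φ N :=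
  LinearMap.mkContinuous
    { toFun := fun ψ => cls (projSeq A φ ψ) (projSeq_bdd A φ D ψ)
      map_add' := fun x y => by
        refine Eq.trans ?_ ((SeparationQuotient.mkCLM ℂ (BddSeq D fun N => subN A φ N)).map_add
          (⟨_, projSeq_bdd A φ D x⟩ : bddSubmodule D fun N => subN A φ N)
          (⟨_, projSeq_bdd A φ D y⟩ : bddSubmodule D fun N => subN A φ N))
        exact congrArg (SeparationQuotient.mkCLM ℂ (BddSeq D fun N => subN A φ N))
          (Subtype.ext (funext fun N => map_add _ x y))
      map_smul' := fun c x => by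
        refine Eq.trans ?_ ((SeparationQuotient.mkCLM ℂ (BddSeq D fun N => subN A φ N)).map_smul c
          (⟨_, projSeq_bdd A φ D x⟩ : bddSubmodule D fun N => subN A φ N))
        exact congrArg (SeparationQuotient.mkCLM ℂ (BddSeq D fun N => subN A φ N))
          (Subtype.ext (funext fun N => map_smul _ c x)) }
    1 (fun ψ => by
      rw [one_mul]
      exact le_of_tendsto' (norm_cls _ (projSeq_bdd A φ D ψ))
        fun _ => Submodule.norm_orthogonalProjectionOnto_apply_le _ _)

/-- `embedding` is the map determined by `ψ ↦ [(ψ)_N]₂` on the union of the spaces `H_N`. -/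
theorem embedding_of_eventually_eq (D : Ultrafilter ℕ) (ψ : H) (v : ∀ N, subN A φ N)
    (h : ∀ᶠ N in (D : Filter ℕ), (v N : H) = ψ) :
    ∃ hv : v ∈ bddSubmodule D fun N => subN A φ N, embedding A φ D ψ = cls v hv := by
  refine ⟨⟨‖ψ‖, ?_⟩, ?_⟩
  · filter_upwards [h] with N hN
    rw [← hN]
    rfl
  · refine (cls_eq_iff _ _ _ _).2 (tendsto_const_nhds.congr' ?_)
    filter_upwards [h] with N hN
    have : projSeq A φ ψ N = v N := by
      rw [← hN]
      exact Submodule.orthogonalProjectionOnto_mem_subspace_eq_self _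
    simp [this]

end Operator

/-! ## The spectral measure -/

section Measure

variable {H : Type*} [NormedAddCommGroup H] [InnerProductSpace ℂ H] [CompleteSpace H]
  {A : H →L[ℂ] H} {φ : H} {r : ℝ}

/-- The weighted counting measure `μ_N(X)`, the sum of `ξ_N(n)²` over all `n` with
`lam N n ∈ X`. -/
noncomputable def muN (E : EigenSystem A φ r) (N : ℕ) (X : Set ℂ) : ℝ :=
  ∑ n, X.indicator (fun _ => E.xi N n ^ 2) (E.lam N n)

/-- The naive measure `μⁿ(X) = lim_D μ_N(X)`. -/
noncomputable def muNaive (D : Ultrafilter ℕ) (E : EigenSystem A φ r) (X : Set ℂ) : ℝ :=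
  limUnder (D : Filter ℕ) fun N => muN E N X

/-- The square `S` with side `2M`. -/
def square (M : ℕ) : Set ℂ := {z | z.re ∈ Set.Icc (-M : ℝ) M ∧ z.im ∈ Set.Icc (-M : ℝ) M}

/-- The strip `I_s^ε` around the vertical line `I_s`. -/
def stripRe (M : ℕ) (s ε : ℝ) : Set ℂ := {z ∈ square M | |z.re - s| < ε}

/-- The strip `J_s^ε` around the horizontal line `J_s`. -/
def stripIm (M : ℕ) (s ε : ℝ) : Set ℂ := {z ∈ square M | |z.im - s| < ε}

/-- The open rectangle in `S` with the given sides. -/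
def openRect (M : ℕ) (a b c d : ℝ) : Set ℂ :=
  {z ∈ square M | z.re ∈ Set.Ioo a b ∧ z.im ∈ Set.Ioo c d}

/-- A real number is nice if thin strips around the corresponding lines have small naive
measure. -/
def IsNice (D : Ultrafilter ℕ) (E : EigenSystem A φ r) (M : ℕ) (s : ℝ) : Prop :=
  ∀ δ > 0, ∃ ε > 0, muNaive D E (stripRe M s ε) < δ ∧ muNaive D E (stripIm M s ε) < δ

/-- A countable dense set `NI` of nice numbers in `[-M, M]` that contains `-M` and `M`. -/
structure NiceSet (D : Ultrafilter ℕ) (E : EigenSystem A φ r) (M : ℕ) where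
  carrier : Set ℝ
  countable : carrier.Countable
  subset : carrier ⊆ Set.Icc (-M : ℝ) M
  dense : Set.Icc (-M : ℝ) M ⊆ closure carrier
  nice : ∀ s ∈ carrier, IsNice D E M s
  left_mem : (-M : ℝ) ∈ carrier
  right_mem : (M : ℝ) ∈ carrier

/-- The family `Sq*` of the open rectangles in `S` whose sides are given by numbers in `NI`. -/
def sqStar {D : Ultrafilter ℕ} {E : EigenSystem A φ r} {M : ℕ} (NI : NiceSet D E M) :
    Set (Set ℂ) :=
  {X | ∃ a ∈ NI.carrier, ∃ b ∈ NI.carrier, ∃ c ∈ NI.carrier, ∃ d ∈ NI.carrier,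
    X = openRect M a b c d}

/-- The outer measure `μ*`: for `Y ⊆ Int S` it is the infimum of the sums `∑ i, μⁿ(X_i)` over the
countable covers of `Y` by sets `X_i ∈ Sq*`, and `μ*(Y) = μ*(Y ∩ Int S)` in general. -/
noncomputable def muStar {D : Ultrafilter ℕ} {E : EigenSystem A φ r} {M : ℕ}
    (NI : NiceSet D E M) : OuterMeasure ℂ :=
  OuterMeasure.restrict (interior (square M))
    (OuterMeasure.boundedBy fun X => ⨅ _ : X ∈ sqStar NI, ENNReal.ofReal (muNaive D E X))

section lemmas

variable (D : Ultrafilter ℕ) (E : EigenSystem A φ r)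

theorem muN_nonneg (N : ℕ) (X : Set ℂ) : 0 ≤ muN E N X :=
  Finset.sum_nonneg fun _ _ => Set.indicator_nonneg (fun _ _ => sq_nonneg _) _

theorem muN_mono (N : ℕ) {X Y : Set ℂ} (h : X ⊆ Y) : muN E N X ≤ muN E N Y :=
  Finset.sum_le_sum fun _ _ => Set.indicator_le_indicator_of_subset h (fun _ => sq_nonneg _) _

theorem muN_union (N : ℕ) {X Y : Set ℂ} (h : Disjoint X Y) :
    muN E N (X ∪ Y) = muN E N X + muN E N Y := by
  simp only [muN, ← Finset.sum_add_distrib]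
  refine Finset.sum_congr rfl fun n _ => ?_
  rw [Set.indicator_union_of_disjoint h]

theorem muN_le (N : ℕ) (X : Set ℂ) : muN E N X ≤ ‖φ‖ ^ 2 := by
  have ho : Orthonormal ℂ fun n => (E.u N n : H) :=
    (E.u N).orthonormal.comp_linearIsometry (subN A φ N).subtypeₗᵢ
  refine le_trans ?_ (ho.sum_inner_products_le (x := φ) (s := Finset.univ))
  refine Finset.sum_le_sum fun n _ => ?_
  have h : ‖inner ℂ (E.u N n : H) φ‖ ^ 2 = E.xi N n ^ 2 := by
    rw [E.inner_eq_xi, Complex.norm_real, Real.norm_eq_abs, sq_abs]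
  rw [h]
  exact Set.indicator_le_self' (fun _ _ => sq_nonneg _) _

theorem tendsto_muN (X : Set ℂ) : Tendsto (fun N => muN E N X) D (𝓝 (muNaive D E X)) :=
  tendsto_limUnder_of_bdd (C := ‖φ‖ ^ 2) (Eventually.of_forall fun N => by
    rw [Real.norm_of_nonneg (muN_nonneg E N X)]
    exact muN_le E N X)

theorem muNaive_nonneg (X : Set ℂ) : 0 ≤ muNaive D E X :=
  ge_of_tendsto' (tendsto_muN D E X) fun N => muN_nonneg E N X

theorem muNaive_mono {X Y : Set ℂ} (h : X ⊆ Y) : muNaive D E X ≤ muNaive D E Y :=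
  le_of_tendsto_of_tendsto' (tendsto_muN D E X) (tendsto_muN D E Y) fun N => muN_mono E N h

theorem muNaive_union {X Y : Set ℂ} (h : Disjoint X Y) :
    muNaive D E (X ∪ Y) = muNaive D E X + muNaive D E Y :=
  tendsto_nhds_unique (tendsto_muN D E _)
    (((tendsto_muN D E X).add (tendsto_muN D E Y)).congr fun N => (muN_union E N h).symm)

variable {D E} {M : ℕ} (NI : NiceSet D E M)

theorem muStar_le {a b c d : ℝ} (ha : a ∈ NI.carrier) (hb : b ∈ NI.carrier)
    (hc : c ∈ NI.carrier) (hd : d ∈ NI.carrier) {Y : Set ℂ}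
    (hY : Y ∩ interior (square M) ⊆ openRect M a b c d) :
    muStar NI Y ≤ ENNReal.ofReal (muNaive D E (openRect M a b c d)) := by
  rw [muStar, OuterMeasure.restrict_apply]
  refine (measure_mono hY).trans ((OuterMeasure.boundedBy_le _).trans ?_)
  exact iInf_le _ ⟨a, ha, b, hb, c, hc, d, hd, rfl⟩

theorem interior_square : interior (square M) ⊆
    {z | z.re ∈ Set.Ioo (-M : ℝ) M ∧ z.im ∈ Set.Ioo (-M : ℝ) M} := by
  have h : square M = Set.Icc (-M : ℝ) M ×ℂ Set.Icc (-M : ℝ) M := rfl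
  rw [h, Complex.interior_reProdIm, interior_Icc]
  exact fun z hz => hz

theorem exists_thin {s : ℝ} (hs : s ∈ NI.carrier) (h1 : -M < s) (h2 : s < M) {δ : ℝ}
    (hδ : 0 < δ) : ∃ a ∈ NI.carrier, ∃ b ∈ NI.carrier, a < s ∧ s < b ∧
      muNaive D E (openRect M a b (-M) M) < δ ∧ muNaive D E (openRect M (-M) M a b) < δ := by
  obtain ⟨ε, hε, hre, him⟩ := NI.nice s hs δ hδ
  have key : ∀ x y : ℝ, x < y → -M ≤ x → y ≤ M → ∃ a ∈ NI.carrier, a ∈ Set.Ioo x y := by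
    intro x y hxy hx hy
    have hm : (x + y) / 2 ∈ closure NI.carrier :=
      NI.dense ⟨by linarith, by linarith⟩
    obtain ⟨a, ha, ha'⟩ := mem_closure_iff.1 hm (Set.Ioo x y) isOpen_Ioo
      ⟨by linarith, by linarith⟩
    exact ⟨a, ha', ha⟩
  obtain ⟨a, ha, ha1, ha2⟩ := key (max (-M) (s - ε)) s (max_lt h1 (by linarith))
    (le_max_left _ _) h2.le
  obtain ⟨b, hb, hb1, hb2⟩ := key s (min M (s + ε)) (lt_min h2 (by linarith)) h1.le
    (min_le_left _ _)
  have ha3 := (max_lt_iff.1 ha1).2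
  have hb3 := (lt_min_iff.1 hb2).2
  refine ⟨a, ha, b, hb, ha2, hb1, lt_of_le_of_lt (muNaive_mono D E ?_) hre,
    lt_of_le_of_lt (muNaive_mono D E ?_) him⟩
  · rintro z ⟨hz, ⟨h3, h4⟩, -⟩
    exact ⟨hz, abs_lt.2 ⟨by linarith, by linarith⟩⟩
  · rintro z ⟨hz, -, ⟨h3, h4⟩⟩
    exact ⟨hz, abs_lt.2 ⟨by linarith, by linarith⟩⟩

theorem isCaratheodory_of_rect (T : Set ℂ)
    (h : ∀ a ∈ NI.carrier, ∀ b ∈ NI.carrier, ∀ c ∈ NI.carrier, ∀ d ∈ NI.carrier, ∀ δ > 0,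
      muStar NI (openRect M a b c d ∩ T) + muStar NI (openRect M a b c d \ T) ≤
        ENNReal.ofReal (muNaive D E (openRect M a b c d) + δ)) :
    (muStar NI).IsCaratheodory T := by
  rw [OuterMeasure.isCaratheodory_iff_le']
  intro Y
  have hle : OuterMeasure.restrict T (muStar NI) + OuterMeasure.restrict Tᶜ (muStar NI) ≤
      OuterMeasure.boundedBy
        fun X => ⨅ _ : X ∈ sqStar NI, ENNReal.ofReal (muNaive D E X) := by
    rw [OuterMeasure.le_boundedBy]
    intro X
    refine le_iInf fun hX => ?_
    obtain ⟨a, ha, b, hb, c, hc, d, hd, rfl⟩ := hX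
    refine ENNReal.le_of_forall_pos_le_add fun δ hδ _ => ?_
    have := h a ha b hb c hc d hd δ hδ
    rw [ENNReal.ofReal_add (muNaive_nonneg D E _) (NNReal.coe_nonneg δ),
      ENNReal.ofReal_coe_nnreal] at this
    simpa [OuterMeasure.restrict_apply, Set.sdiff_eq] using this
  have hY := hle (Y ∩ interior (square M))
  have e1 : muStar NI (Y ∩ T) = muStar NI (Y ∩ interior (square M) ∩ T) := by
    simp only [muStar, OuterMeasure.restrict_apply]
    congr 1
    ext z
    simp only [Set.mem_inter_iff]
    tauto
  have e2 : muStar NI (Y \ T) = muStar NI ((Y ∩ interior (square M)) \ T) := by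
    simp only [muStar, OuterMeasure.restrict_apply]
    congr 1
    ext z
    simp only [Set.mem_inter_iff, Set.mem_sdiff]
    tauto
  rw [e1, e2]
  simpa [OuterMeasure.restrict_apply, Set.sdiff_eq, muStar] using hY

theorem minmax_mem {a c : ℝ} (ha : a ∈ NI.carrier) (hc : c ∈ NI.carrier) :
    max a c ∈ NI.carrier ∧ min a c ∈ NI.carrier := by
  rcases le_total a c with h | h <;> simp [h, ha, hc]

theorem isCaratheodory_re {s : ℝ} (hs : s ∈ NI.carrier) (h1 : -M < s) (h2 : s < M) :
    (muStar NI).IsCaratheodory {z | z.re < s} := by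
  refine isCaratheodory_of_rect NI _ fun a ha b hb c hc d hd δ hδ => ?_
  obtain ⟨x, hx, y, hy, hxs, hsy, hlt, -⟩ := exists_thin NI hs h1 h2 hδ
  have i1 : muStar NI (openRect M a b c d ∩ {z | z.re < s}) ≤
      ENNReal.ofReal (muNaive D E (openRect M a (min b s) c d)) := by
    refine muStar_le NI ha (minmax_mem NI hb hs).2 hc hd ?_
    rintro z ⟨⟨⟨hz, hz1, hz2⟩, hz3⟩, -⟩
    exact ⟨hz, ⟨hz1.1, lt_min hz1.2 hz3⟩, hz2⟩
  have i2 : muStar NI (openRect M a b c d \ {z | z.re < s}) ≤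
      ENNReal.ofReal (muNaive D E (openRect M (max a s) b c d)) +
        ENNReal.ofReal (muNaive D E (openRect M x y (-M) M)) := by
    have hsub : openRect M a b c d \ {z | z.re < s} ⊆
        openRect M (max a s) b c d ∪ (openRect M a b c d ∩ {z | z.re = s}) := by
      rintro z ⟨⟨hz, hz1, hz2⟩, hz3⟩
      have hz4 : ¬ z.re < s := hz3
      rcases (not_lt.1 hz4).eq_or_lt with h | h
      · exact Or.inr ⟨⟨hz, hz1, hz2⟩, h.symm⟩
      · exact Or.inl ⟨hz, ⟨max_lt hz1.1 h, hz1.2⟩, hz2⟩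
    refine (measure_mono hsub).trans ((measure_union_le _ _).trans (add_le_add ?_ ?_))
    · exact muStar_le NI (minmax_mem NI ha hs).1 hb hc hd Set.inter_subset_left
    · refine muStar_le NI hx hy NI.left_mem NI.right_mem ?_
      rintro z ⟨⟨⟨hz, -⟩, hz3⟩, hz4⟩
      have hz3' : z.re = s := hz3
      exact ⟨hz, ⟨by linarith, by linarith⟩, (interior_square hz4).2⟩
  have hd' : Disjoint (openRect M a (min b s) c d) (openRect M (max a s) b c d) := by
    refine Set.disjoint_left.2 ?_
    rintro z ⟨-, ⟨-, h3⟩, -⟩ ⟨-, ⟨h4, -⟩, -⟩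
    exact absurd ((lt_min_iff.1 h3).2.trans (max_lt_iff.1 h4).2) (lt_irrefl _)
  have i3 : muNaive D E (openRect M a (min b s) c d) + muNaive D E (openRect M (max a s) b c d) ≤
      muNaive D E (openRect M a b c d) := by
    rw [← muNaive_union D E hd']
    refine muNaive_mono D E (Set.union_subset ?_ ?_)
    · rintro z ⟨hz, ⟨h3, h4⟩, h5⟩
      exact ⟨hz, ⟨h3, (lt_min_iff.1 h4).1⟩, h5⟩
    · rintro z ⟨hz, ⟨h3, h4⟩, h5⟩
      exact ⟨hz, ⟨(max_lt_iff.1 h3).1, h4⟩, h5⟩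
  refine (add_le_add i1 i2).trans ?_
  have n := muNaive_nonneg D E
  rw [← ENNReal.ofReal_add (n _) (n _), ← ENNReal.ofReal_add (n _) (add_nonneg (n _) (n _))]
  exact ENNReal.ofReal_le_ofReal (by linarith)

theorem isCaratheodory_im {s : ℝ} (hs : s ∈ NI.carrier) (h1 : -M < s) (h2 : s < M) :
    (muStar NI).IsCaratheodory {z | z.im < s} := by
  refine isCaratheodory_of_rect NI _ fun c hc d hd a ha b hb δ hδ => ?_
  obtain ⟨x, hx, y, hy, hxs, hsy, -, hlt⟩ := exists_thin NI hs h1 h2 hδ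
  have i1 : muStar NI (openRect M c d a b ∩ {z | z.im < s}) ≤
      ENNReal.ofReal (muNaive D E (openRect M c d a (min b s))) := by
    refine muStar_le NI hc hd ha (minmax_mem NI hb hs).2 ?_
    rintro z ⟨⟨⟨hz, hz2, hz1⟩, hz3⟩, -⟩
    exact ⟨hz, hz2, ⟨hz1.1, lt_min hz1.2 hz3⟩⟩
  have i2 : muStar NI (openRect M c d a b \ {z | z.im < s}) ≤
      ENNReal.ofReal (muNaive D E (openRect M c d (max a s) b)) +
        ENNReal.ofReal (muNaive D E (openRect M (-M) M x y)) := by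
    have hsub : openRect M c d a b \ {z | z.im < s} ⊆
        openRect M c d (max a s) b ∪ (openRect M c d a b ∩ {z | z.im = s}) := by
      rintro z ⟨⟨hz, hz2, hz1⟩, hz3⟩
      have hz4 : ¬ z.im < s := hz3
      rcases (not_lt.1 hz4).eq_or_lt with h | h
      · exact Or.inr ⟨⟨hz, hz2, hz1⟩, h.symm⟩
      · exact Or.inl ⟨hz, hz2, ⟨max_lt hz1.1 h, hz1.2⟩⟩
    refine (measure_mono hsub).trans ((measure_union_le _ _).trans (add_le_add ?_ ?_))
    · exact muStar_le NI hc hd (minmax_mem NI ha hs).1 hb Set.inter_subset_left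
    · refine muStar_le NI NI.left_mem NI.right_mem hx hy ?_
      rintro z ⟨⟨⟨hz, -⟩, hz3⟩, hz4⟩
      have hz3' : z.im = s := hz3
      exact ⟨hz, (interior_square hz4).1, ⟨by linarith, by linarith⟩⟩
  have hd' : Disjoint (openRect M c d a (min b s)) (openRect M c d (max a s) b) := by
    refine Set.disjoint_left.2 ?_
    rintro z ⟨-, -, ⟨-, h3⟩⟩ ⟨-, -, ⟨h4, -⟩⟩
    exact absurd ((lt_min_iff.1 h3).2.trans (max_lt_iff.1 h4).2) (lt_irrefl _)
  have i3 : muNaive D E (openRect M c d a (min b s)) + muNaive D E (openRect M c d (max a s) b) ≤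
      muNaive D E (openRect M c d a b) := by
    rw [← muNaive_union D E hd']
    refine muNaive_mono D E (Set.union_subset ?_ ?_)
    · rintro z ⟨hz, h5, ⟨h3, h4⟩⟩
      exact ⟨hz, h5, ⟨h3, (lt_min_iff.1 h4).1⟩⟩
    · rintro z ⟨hz, h5, ⟨h3, h4⟩⟩
      exact ⟨hz, h5, ⟨(max_lt_iff.1 h3).1, h4⟩⟩
  refine (add_le_add i1 i2).trans ?_
  have n := muNaive_nonneg D E
  rw [← ENNReal.ofReal_add (n _) (n _), ← ENNReal.ofReal_add (n _) (add_nonneg (n _) (n _))]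
  exact ENNReal.ofReal_le_ofReal (by linarith)

theorem isCaratheodory_lt (f : ℂ → ℝ)
    (hf : ∀ z ∈ interior (square M), f z ∈ Set.Ioo (-M : ℝ) M)
    (h : ∀ s ∈ NI.carrier, -M < s → s < M → (muStar NI).IsCaratheodory {z | f z < s}) (t : ℝ) :
    (muStar NI).IsCaratheodory {z | f z < t} := by
  have triv : ∀ T : Set ℂ, (∀ z ∈ interior (square M), z ∈ T) → (muStar NI).IsCaratheodory T := by
    intro T hT
    rw [OuterMeasure.isCaratheodory_iff_le']
    intro Y
    have : muStar NI (Y \ T) = 0 := by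
      rw [muStar, OuterMeasure.restrict_apply, ← nonpos_iff_eq_zero]
      refine (measure_mono (t := ∅) ?_).trans (by simp)
      rintro z ⟨⟨-, h1⟩, h2⟩
      exact h1 (hT z h2)
    rw [this, add_zero]
    exact measure_mono Set.inter_subset_left
  rcases le_or_gt (M : ℝ) t with h1 | h1
  · exact triv _ fun z hz => (hf z hz).2.trans_le h1
  rcases le_or_gt t (-M) with h2 | h2
  · rw [← OuterMeasure.isCaratheodory_compl_iff]
    exact triv _ fun z hz => not_lt.2 (h2.trans (hf z hz).1.le)
  by_cases ht : t ∈ NI.carrier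
  · exact h t ht h2 h1
  have hlub : IsLUB (NI.carrier ∩ Set.Iio t) t := by
    refine ⟨fun x hx => hx.2.le, fun y hy => ?_⟩
    by_contra! hyt
    have hm : (max y (-M) + t) / 2 ∈ closure NI.carrier := by
      refine NI.dense ⟨?_, ?_⟩
      · linarith [le_max_right y (-M : ℝ)]
      · linarith [max_lt hyt h2]
    have hlt := max_lt hyt h2
    obtain ⟨a, ha, ha'⟩ := mem_closure_iff.1 hm (Set.Ioo (max y (-M)) t) isOpen_Ioo
      ⟨by linarith, by linarith⟩
    exact absurd (hy ⟨ha', ha.2⟩) (not_le.2 ((le_max_left _ _).trans_lt ha.1))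
  obtain ⟨v, hv1, hv2, hv3, hv4⟩ := hlub.exists_seq_strictMono_tendsto_of_notMem
    (fun hx => ht hx.1) ⟨-M, NI.left_mem, h2⟩
  have e : {z | f z < t} = ⋃ i, {z | f z < v (i + 1)} := by
    ext z
    simp only [Set.mem_ofPred_eq, Set.mem_iUnion]
    constructor
    · intro hz
      exact ((hv3.comp (tendsto_add_atTop_nat 1)).eventually_const_lt hz).exists
    · rintro ⟨i, hi⟩
      exact hi.trans (hv2 _)
  rw [e]
  refine OuterMeasure.isCaratheodory_iUnion _ fun i => ?_
  refine h _ (hv4 _).1 ?_ ((hv2 _).trans h1)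
  exact lt_of_le_of_lt (NI.subset (hv4 0).1).1 (hv1 (Nat.succ_pos i))

theorem measurable_re_im {m : MeasurableSpace ℂ}
    (hre : ∀ t, MeasurableSet[m] {z : ℂ | z.re < t})
    (him : ∀ t, MeasurableSet[m] {z : ℂ | z.im < t}) :
    Measurable[m] fun z : ℂ => (z.re, z.im) :=
  (measurable_of_Iio hre).prodMk (measurable_of_Iio him)

/-- Every Borel set is measurable for `μ*`. -/
theorem borel_le_caratheodory : borel ℂ ≤ (muStar NI).caratheodory := by
  have hp := measurable_re_im (m := (muStar NI).caratheodory)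
    (fun t => isCaratheodory_lt NI Complex.re (fun z hz => (interior_square hz).1)
        (fun s hs h1 h2 => isCaratheodory_re NI hs h1 h2) t)
    (fun t => isCaratheodory_lt NI Complex.im (fun z hz => (interior_square hz).2)
        (fun s hs h1 h2 => isCaratheodory_im NI hs h1 h2) t)
  intro s hs
  have hs' : MeasurableSet (Complex.measurableEquivRealProd.symm ⁻¹' s) :=
    Complex.measurableEquivRealProd.symm.measurable
      (by rwa [BorelSpace.measurable_eq (α := ℂ)])
  have h2 := hp hs'
  have e : (fun z : ℂ => (z.re, z.im)) ⁻¹' (Complex.measurableEquivRealProd.symm ⁻¹' s) = s := by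
    ext z
    exact Iff.rfl
  rw [e] at h2
  exact h2

end lemmas

/-- The spectral measure `μ`, the restriction of `μ*` to the Borel sets. -/
noncomputable def spectralMeasure {D : Ultrafilter ℕ} {E : EigenSystem A φ r} {M : ℕ}
    (NI : NiceSet D E M) : Measure ℂ :=
  (muStar NI).toMeasure ((BorelSpace.measurable_eq (α := ℂ)).le.trans (borel_le_caratheodory NI))

end Measure

/-! ## Operators with a continuous kernel -/

section Kernel

variable {H : Type*} [NormedAddCommGroup H] [InnerProductSpace ℂ H] [CompleteSpace H]

/-- `IsL2Image A φ μ f ψ` says that the unitary operator `L₂(σ(A), μ) → H` which is determined by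
`f_P ↦ P(A, A*) φ`, `P ∈ ℂ[X, Y]`, maps the class of `f` to `ψ`: the pair `(f, ψ)` belongs to the
closure of the set of the pairs `(f_P, P(A, A*) φ)`. -/
def IsL2Image (A : H →L[ℂ] H) (φ : H) (μ : Measure ℂ) (f : ℂ → ℂ) (ψ : H) : Prop :=
  AEStronglyMeasurable f (μ.restrict (spectrum ℂ A)) ∧
  ∀ ε > 0, ∃ P : MvPolynomial (Fin 2) ℂ, ‖ψ - polyOp A P φ‖ < ε ∧
    eLpNorm (f - polyFun P) 2 (μ.restrict (spectrum ℂ A)) < ENNReal.ofReal ε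

/-- `B`, transported to `L₂(σ(A), μ)`, has the continuous kernel `K : σ(A)² → ℂ`: for every
`P ∈ ℂ[X, Y]` the image of the class of `f_P` under the transported operator is the class of a
continuous function `g` with `g(y) = ∫_{σ(A)} K(x, y) f_P(x) dμ(x)` for all `y ∈ σ(A)`. -/
def HasKernel (A : H →L[ℂ] H) (φ : H) (μ : Measure ℂ) (B : H →ₗ[ℂ] H) (K : ℂ → ℂ → ℂ) : Prop :=
  ContinuousOn (Function.uncurry K) (spectrum ℂ A ×ˢ spectrum ℂ A) ∧
  ∀ P : MvPolynomial (Fin 2) ℂ, ∃ g : ℂ → ℂ, ContinuousOn g (spectrum ℂ A) ∧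
    IsL2Image A φ μ g (B (polyOp A P φ)) ∧
    ∀ y ∈ spectrum ℂ A, g y = ∫ x in spectrum ℂ A, K x y * polyFun P x ∂μ

end Kernel

/-! ## Grids and averaging vectors -/

section Grid

variable {H : Type*} [NormedAddCommGroup H] [InnerProductSpace ℂ H] [CompleteSpace H]
  {A : H →L[ℂ] H} {φ : H} {r : ℝ}

/-- The set `R^n_ε`, the union of the `ε`-strips around the lines of the `n`-th grid. -/
def gridStrip (M : ℕ) (s : ℕ → ℕ → ℝ) (n : ℕ) (ε : ℝ) : Set ℂ :=
  ⋃ i ∈ Set.Iic (2 ^ (n + 2)), stripRe M (s n i) ε ∪ stripIm M (s n i) ε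

/-- The requirements on the numbers `s n i`, `i < 2^{n+2} + 1`, which determine the lines of the
`n`-th grid: they are increasing with small gaps, each grid refines the previous one, the lines
avoid the points `α` and `β`, and thin strips around them have small naive measure. -/
structure IsGrid (D : Ultrafilter ℕ) (E : EigenSystem A φ r) (M : ℕ) (α β : ℂ)
    (s : ℕ → ℕ → ℝ) : Prop where
  mem : ∀ n, ∀ i ≤ 2 ^ (n + 2), s n i ∈ Set.Icc (-M : ℝ) M
  lt : ∀ n, ∀ i < 2 ^ (n + 2), s n i < s n (i + 1)
  gap : ∀ n, ∀ i < 2 ^ (n + 2), s n (i + 1) - s n i < 2 * M / (n + 1)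
  avoid : ∀ n, ∀ i ≤ 2 ^ (n + 2),
    s n i ≠ α.re ∧ s n i ≠ α.im ∧ s n i ≠ β.re ∧ s n i ≠ β.im
  small : ∀ n, ∀ δ > 0, ∃ ε > 0, muNaive D E (gridStrip M s n ε) < δ
  left : s 0 0 = -M
  right : s 0 4 = M
  refines : ∀ n, ∀ i ≤ 2 ^ (n + 2), ∃ j ≤ 2 ^ (n + 3), s n i = s (n + 1) j

/-- The open box `B^n_{ij}`. -/
def gridBox (M : ℕ) (s : ℕ → ℕ → ℝ) (n i j : ℕ) : Set ℂ :=
  openRect M (s n i) (s n (i + 1)) (s n j) (s n (j + 1))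

/-- `B^p_α`, the box `B^p_{ij}`, `i, j < 2^{p+2}`, that contains `α`. -/
def boxAt (M : ℕ) (s : ℕ → ℕ → ℝ) (p : ℕ) (α : ℂ) : Set ℂ :=
  {z | ∃ i < 2 ^ (p + 2), ∃ j < 2 ^ (p + 2), α ∈ gridBox M s p i j ∧ z ∈ gridBox M s p i j}

open Classical in
/-- The averaging vector
`u^p_α(N) = ∑ (ξ_N(k) / μ_N(B^p_α)) u_N(k)`, the sum over all `k` with `lam N k ∈ B^p_α`. -/
noncomputable def averageVec (E : EigenSystem A φ r) (M : ℕ) (s : ℕ → ℕ → ℝ) (p : ℕ) (α : ℂ)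
    (N : ℕ) : subN A φ N :=
  ∑ k with E.lam N k ∈ boxAt M s p α,
    ((E.xi N k / muN E N (boxAt M s p α) : ℝ) : ℂ) • E.u N k

end Grid

end KernelLimit

/-! Each `A_N` is `√r` times a unitary: `A` scales inner products by `r` and carries `H_N⁻` into
`H_N⁺`, while `U_N` carries the complement of the one onto the complement of the other. So its
eigenvalues lie on the circle `‖z‖ = √r`, and for all large `N` the coordinates of `P(A, A*) φ` in
the eigenbasis are `f_P(λ_N(n)) ξ_N(n)` (`hasSymbol_polyOp`). Inner products of such vectors are
thus integrals against the atomic measures with mass `ξ_N(n)²` at `λ_N(n)`.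

The circle is compact, so these probability measures have a weak limit `ν` along `D`
(`exists_isLimitMeasure`). Rectangles with nice sides have `ν`-null boundary, hence `ν` agrees on
them with the naive measure, and a comparison of total masses shows that `ν` is the spectral measure
(`IsLimitMeasure.eq_spectralMeasure`). It is carried by `σ(A)` and charges every neighbourhood of
every point of `σ(A)` (`IsLimitMeasure.ae_mem_spectrum`, `IsLimitMeasure.ball_ne_zero`), so the
boxes around `α` and `β` have positive measure.

The averaging vector of a box `S` represents `μ(S)⁻¹` times the class of the spectral projection of
`φ` to `S`. That class is a limit of embedded vectors `P(A, A*) φ` with `f_P` tending to the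
indicator of `S` in `L¹(ν)` (`IsLimitMeasure.exists_poly_window`). On such vectors (C2) and the
kernel turn matrix coefficients of `B^m` into double integrals of `conj f_Q(y) K(x, y) f_P(x)`. As
`K` is bounded on the compact set `σ(A)²`, this form is `L¹`-continuous and the formula passes to
indicators (`IsLimitMeasure.inner_window`). Hence the inner product in question is the mean of `K`
over the product of the two boxes; these shrink to `(α, β)`, where `K` is continuous. -/

namespace KernelLimit

/-! ### Eigenbasis coordinates of polynomial vectors. -/

section Symbol

variable {H : Type*} [NormedAddCommGroup H] [InnerProductSpace ℂ H] [CompleteSpace H]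
  {A : H →L[ℂ] H} {φ : H} {r : ℝ} {N : ℕ}

theorem inner_map_map_of_star_mul (hA : star A * A = (r : ℂ) • (1 : H →L[ℂ] H)) (x y : H) :
    inner ℂ (A x) (A y) = (r : ℂ) * inner ℂ x y := by
  rw [← ContinuousLinearMap.adjoint_inner_right, ← ContinuousLinearMap.star_eq_adjoint,
    ← mul_apply_eq_comp, hA]
  exact inner_smul_right _ _ _

theorem map_mem_subPlus {v : H} (hv : v ∈ subMinus A φ N) : A v ∈ subPlus A φ N := by
  have h : subMinus A φ N ≤ (subPlus A φ N).comap (A : H →ₗ[ℂ] H) := by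
    refine Submodule.span_le.2 ?_
    rintro x ⟨i, j, hi, hj, rfl⟩
    refine Submodule.subset_span ⟨i + 1, j, Nat.succ_pos i, hi, hj, ?_⟩
    simp [pow_succ', mul_assoc]
  exact h hv

theorem exists_minus_add_comp (v : subN A φ N) :
    ∃ (m : subN A φ N) (w : compMinus A φ N), (m : H) ∈ subMinus A φ N ∧
      v = m + ⟨w, (Submodule.mem_inf.1 w.2).2⟩ := by
  have hm := Submodule.starProjection_apply_mem (subMinus A φ N) (v : H)
  have hw : (v : H) - (subMinus A φ N).starProjection v ∈ compMinus A φ N :=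
    Submodule.mem_inf.2 ⟨Submodule.sub_starProjection_mem_orthogonal _,
      sub_mem v.2 (subMinus_le A φ N hm)⟩
  exact ⟨⟨_, subMinus_le A φ N hm⟩, ⟨_, hw⟩, hm, Subtype.ext (by simp)⟩

/-- The cross terms vanish: `A` maps `H_N⁻` into `H_N⁺`, which is orthogonal to the range of `U`. On
the two diagonal terms the factor `r` comes from `A*A = r` and from `(√r)²`. -/
theorem inner_approxOp (hr : 0 < r) (hA : star A * A = (r : ℂ) • (1 : H →L[ℂ] H))
    (U : compMinus A φ N ≃ₗᵢ[ℂ] compPlus A φ N) (x y : subN A φ N) :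
    inner ℂ (approxOp r U x) (approxOp r U y) = (r : ℂ) * inner ℂ x y := by
  obtain ⟨m, w, hm, rfl⟩ := exists_minus_add_comp x
  obtain ⟨m', w', hm', rfl⟩ := exists_minus_add_comp y
  have h1 : ∀ (a : H) (b : compMinus A φ N), a ∈ subMinus A φ N → inner ℂ a (b : H) = 0 :=
    fun a b ha => (Submodule.mem_orthogonal _ _).1 (Submodule.mem_inf.1 b.2).1 _ ha
  have h2 : ∀ (a : H) (b : compMinus A φ N), a ∈ subMinus A φ N → inner ℂ (A a) (U b : H) = 0 :=
    fun a b ha => (Submodule.mem_orthogonal _ _).1 (Submodule.mem_inf.1 (U b).2).1 _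
      (map_mem_subPlus ha)
  have h3 : inner ℂ (w : H) (m' : H) = 0 := inner_eq_zero_symm.1 (h1 _ _ hm')
  have h4 : inner ℂ (U w : H) (A m' : H) = 0 := inner_eq_zero_symm.1 (h2 _ _ hm')
  have h5 : inner ℂ (U w : H) (U w' : H) = inner ℂ (w : H) (w' : H) := U.inner_map_map w w'
  have h6 : (√r : ℂ) * (√r : ℂ) = (r : ℂ) := by
    rw [← Complex.ofReal_mul, Real.mul_self_sqrt hr.le]
  simp only [map_add, Submodule.coe_inner, approxOp_minus r U m hm,
    approxOp_minus r U m' hm', approxOp_comp, inner_add_left, inner_add_right, inner_smul_left,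
    inner_smul_right, h1 _ w' hm, h2 _ w' hm, h3, h4, h5, Complex.conj_ofReal,
    inner_map_map_of_star_mul hA]
  linear_combination inner ℂ (w : H) (w' : H) * h6

variable {E : EigenSystem A φ r}

theorem conj_lam_mul_lam (hr : 0 < r) (hA : star A * A = (r : ℂ) • (1 : H →L[ℂ] H))
    (n : Fin (Module.finrank ℂ (subN A φ N))) :
    (starRingEnd ℂ) (E.lam N n) * E.lam N n = (r : ℂ) := by
  have h := inner_approxOp hr hA (E.U N) (E.u N n) (E.u N n)
  rw [E.eigen, inner_smul_left, inner_smul_right, inner_self_eq_norm_sq_to_K,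
    (E.u N).norm_eq_one] at h
  simpa using h

theorem norm_lam (hr : 0 < r) (hA : star A * A = (r : ℂ) • (1 : H →L[ℂ] H))
    (n : Fin (Module.finrank ℂ (subN A φ N))) : ‖E.lam N n‖ = √r := by
  have h := conj_lam_mul_lam (E := E) hr hA n
  rw [← Complex.normSq_eq_conj_mul_self, Complex.ofReal_inj, Complex.normSq_eq_norm_sq] at h
  exact ((Real.sqrt_eq_iff_eq_sq hr.le (norm_nonneg _)).2 h.symm).symm

/-- Since `A_N` scales inner products, `conj λ ⟨u, A w⟩ = r ⟨u, w⟩`; multiplying by `λ` and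
cancelling `conj λ * λ = r` gives the claim without the adjoint of `A_N`. -/
theorem inner_u_map (hr : 0 < r) (hA : star A * A = (r : ℂ) • (1 : H →L[ℂ] H))
    (n : Fin (Module.finrank ℂ (subN A φ N))) {w : H} (hw : w ∈ subMinus A φ N) :
    inner ℂ (E.u N n : H) (A w) = E.lam N n * inner ℂ (E.u N n : H) w := by
  have h := inner_approxOp hr hA (E.U N) (E.u N n) ⟨w, subMinus_le A φ N hw⟩
  rw [E.eigen, inner_smul_left] at h
  simp only [Submodule.coe_inner, approxOp_minus r (E.U N) ⟨w, subMinus_le A φ N hw⟩ hw] at h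
  have h2 := conj_lam_mul_lam (E := E) hr hA n
  have h3 : (r : ℂ) ≠ 0 := by exact_mod_cast hr.ne'
  refine mul_left_cancel₀ h3 ?_
  linear_combination E.lam N n * h - inner ℂ (E.u N n : H) (A w) * h2

/-- `A_N` imitates `A`, not `A*`. But `A (A*)^(j+1) φ = r (A*)^j φ`, so `inner_u_map` can be read
backwards, division by `λ` being multiplication by `conj λ / r`. -/
theorem inner_u_star_pow (hr : 0 < r) (hA : star A * A = (r : ℂ) • (1 : H →L[ℂ] H))
    (hA' : A * star A = (r : ℂ) • (1 : H →L[ℂ] H)) (hN : 0 < N)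
    (n : Fin (Module.finrank ℂ (subN A φ N))) {j : ℕ} (hj : j ≤ N) :
    inner ℂ (E.u N n : H) ((star A ^ j) φ) = (starRingEnd ℂ) (E.lam N n) ^ j * E.xi N n := by
  induction j with
  | zero => simp [E.inner_eq_xi]
  | succ j ih =>
    -- With exponent `0` of `A`, membership in `H_N⁻` requires exactly `0 < N`.
    have hm : (star A ^ (j + 1)) φ ∈ subMinus A φ N :=
      Submodule.subset_span ⟨0, j + 1, hN, hj, by simp⟩
    have h := inner_u_map (E := E) hr hA n hm
    have e : A ((star A ^ (j + 1)) φ) = (r : ℂ) • (star A ^ j) φ := by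
      rw [pow_succ', ← mul_apply_eq_comp, ← mul_assoc, hA']
      simp
    rw [e, inner_smul_right, ih (by omega)] at h
    have h2 := conj_lam_mul_lam (E := E) hr hA n
    have h3 : (r : ℂ) ≠ 0 := by exact_mod_cast hr.ne'
    refine mul_left_cancel₀ h3 ?_
    rw [pow_succ ((starRingEnd ℂ) (E.lam N n))]
    linear_combination (-(starRingEnd ℂ) (E.lam N n)) * h -
      inner ℂ (E.u N n : H) ((star A ^ (j + 1)) φ) * h2

theorem inner_u_monomial (hr : 0 < r) (hA : star A * A = (r : ℂ) • (1 : H →L[ℂ] H))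
    (hA' : A * star A = (r : ℂ) • (1 : H →L[ℂ] H)) (hN : 0 < N)
    (n : Fin (Module.finrank ℂ (subN A φ N))) {i j : ℕ} (hi : i ≤ N) (hj : j ≤ N) :
    inner ℂ (E.u N n : H) ((A ^ i * star A ^ j) φ) =
      E.lam N n ^ i * (starRingEnd ℂ) (E.lam N n) ^ j * E.xi N n := by
  induction i with
  | zero => rw [pow_zero, one_mul, pow_zero, one_mul, inner_u_star_pow hr hA hA' hN n hj]
  | succ i ih =>
    have hm : (A ^ i * star A ^ j) φ ∈ subMinus A φ N :=
      Submodule.subset_span ⟨i, j, hi, hj, rfl⟩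
    have h := inner_u_map (E := E) hr hA n hm
    rw [pow_succ', mul_assoc, mul_apply_eq_comp, h, ih (by omega)]
    ring

theorem subN_le_subMinus {N N' : ℕ} (h : N < N') : subN A φ N ≤ subMinus A φ N' :=
  Submodule.span_mono fun _ ⟨i, j, hi, hj, e⟩ => ⟨i, j, hi.trans_lt h, hj.trans h.le, e⟩

/-- `ψ = f(A) φ` on the level of the approximations: for all large `N` the coordinates of `ψ`
with respect to the eigenbasis of `A_N` are `f (lam N n) * xi N n`. -/
def HasSymbol (E : EigenSystem A φ r) (ψ : H) (f : ℂ → ℂ) : Prop :=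
  ∀ᶠ N in atTop, ψ ∈ subN A φ N ∧ ∀ n, inner ℂ (E.u N n : H) ψ = f (E.lam N n) * E.xi N n

theorem HasSymbol.smul {ψ : H} {f : ℂ → ℂ} (h : HasSymbol E ψ f) (c : ℂ) :
    HasSymbol E (c • ψ) fun z => c * f z := by
  filter_upwards [h] with N hN
  refine ⟨Submodule.smul_mem _ _ hN.1, fun n => ?_⟩
  rw [inner_smul_right, hN.2, mul_assoc]

theorem HasSymbol.sub {ψ ψ' : H} {f f' : ℂ → ℂ} (h : HasSymbol E ψ f) (h' : HasSymbol E ψ' f') :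
    HasSymbol E (ψ - ψ') fun z => f z - f' z := by
  filter_upwards [h, h'] with N hN hN'
  refine ⟨sub_mem hN.1 hN'.1, fun n => ?_⟩
  rw [inner_sub_right, hN.2, hN'.2, sub_mul]

theorem HasSymbol.sum {ι : Type*} (s : Finset ι) {ψ : ι → H} {f : ι → ℂ → ℂ}
    (h : ∀ i ∈ s, HasSymbol E (ψ i) (f i)) :
    HasSymbol E (∑ i ∈ s, ψ i) fun z => ∑ i ∈ s, f i z := by
  filter_upwards [(Filter.eventually_all_finset s).2 h] with N hN
  refine ⟨sum_mem fun i hi => (hN i hi).1, fun n => ?_⟩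
  rw [inner_sum, Finset.sum_mul]
  exact Finset.sum_congr rfl fun i hi => (hN i hi).2 n

theorem HasSymbol.map (hr : 0 < r) (hA : star A * A = (r : ℂ) • (1 : H →L[ℂ] H))
    {ψ : H} {f : ℂ → ℂ} (h : HasSymbol E ψ f) : HasSymbol E (A ψ) fun z => z * f z := by
  obtain ⟨N₀, hN₀⟩ := eventually_atTop.1 h
  filter_upwards [eventually_gt_atTop N₀] with N hN
  -- A vector of the fixed space `H_{N₀}` lies in `H_N⁻` for every `N > N₀`, where `A_N` acts as
  -- `A`.
  have hm := subN_le_subMinus hN (hN₀ N₀ le_rfl).1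
  refine ⟨map_subMinus A φ N hm, fun n => ?_⟩
  rw [inner_u_map hr hA n hm, (hN₀ N hN.le).2, mul_assoc]

theorem hasSymbol_monomial (hr : 0 < r) (hA : star A * A = (r : ℂ) • (1 : H →L[ℂ] H))
    (hA' : A * star A = (r : ℂ) • (1 : H →L[ℂ] H)) (i j : ℕ) :
    HasSymbol E ((A ^ i * star A ^ j) φ) fun z => z ^ i * (starRingEnd ℂ) z ^ j := by
  filter_upwards [eventually_gt_atTop 0, eventually_ge_atTop i, eventually_ge_atTop j]
    with N hN hi hj
  exact ⟨Submodule.subset_span ⟨i, j, hi, hj, rfl⟩, fun n =>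
    inner_u_monomial hr hA hA' hN n hi hj⟩

theorem hasSymbol_polyOp (hr : 0 < r) (hA : star A * A = (r : ℂ) • (1 : H →L[ℂ] H))
    (hA' : A * star A = (r : ℂ) • (1 : H →L[ℂ] H)) (P : MvPolynomial (Fin 2) ℂ) :
    HasSymbol E (polyOp A P φ) (polyFun P) := by
  have h := HasSymbol.sum (E := E) P.support fun m _ =>
    (hasSymbol_monomial (E := E) hr hA hA' (m 0) (m 1)).smul (P.coeff m)
  have e1 : polyOp A P φ = ∑ m ∈ P.support, P.coeff m • (A ^ m 0 * star A ^ m 1) φ := by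
    simp [polyOp]
  have e2 : polyFun P = fun z => ∑ m ∈ P.support,
      P.coeff m * (z ^ m 0 * (starRingEnd ℂ) z ^ m 1) := by
    funext z
    simp [polyFun, MvPolynomial.eval_eq', Fin.prod_univ_two]
  rw [e1, e2]
  exact h

theorem continuous_polyFun (P : MvPolynomial (Fin 2) ℂ) : Continuous (polyFun P) := by
  refine (MvPolynomial.continuous_eval P).comp (continuous_pi fun i => ?_)
  fin_cases i
  · exact continuous_id
  · exact Complex.continuous_conj

/-- Parseval's identity. Only the first vector has to lie in `H_N`, as pairing with it sees the
second one through its projection to `H_N`. -/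
theorem inner_eq_sum {ψ ψ' : H} {f f' : ℂ → ℂ} (hψ : ψ ∈ subN A φ N)
    (h : ∀ n, inner ℂ (E.u N n : H) ψ = f (E.lam N n) * E.xi N n)
    (h' : ∀ n, inner ℂ (E.u N n : H) ψ' = f' (E.lam N n) * E.xi N n) :
    inner ℂ ψ ψ' = ∑ n, (starRingEnd ℂ) (f (E.lam N n)) * f' (E.lam N n) * (E.xi N n : ℂ) ^ 2 := by
  have e := (E.u N).sum_repr ⟨ψ, hψ⟩
  have e' : ψ = ∑ n, inner ℂ (E.u N n : H) ψ • (E.u N n : H) := by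
    have := congrArg (Subtype.val) e
    rw [Submodule.coe_sum] at this
    refine this.symm.trans (Finset.sum_congr rfl fun n _ => ?_)
    rw [Submodule.coe_smul, (E.u N).repr_apply_apply]
    rfl
  conv_lhs => rw [e']
  rw [sum_inner]
  refine Finset.sum_congr rfl fun n _ => ?_
  rw [inner_smul_left, h, h', map_mul, Complex.conj_ofReal]
  ring

theorem sum_xi_sq (E : EigenSystem A φ r) (hφ : ‖φ‖ = 1) (N : ℕ) : ∑ n, E.xi N n ^ 2 = 1 := by
  have hm : φ ∈ subN A φ N := Submodule.subset_span ⟨0, 0, N.zero_le, N.zero_le, by simp⟩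
  have h := inner_eq_sum (E := E) (ψ' := φ) (f := fun _ => 1) (f' := fun _ => 1) hm
    (fun n => by simp [E.inner_eq_xi]) (fun n => by simp [E.inner_eq_xi])
  rw [inner_self_eq_norm_sq_to_K, hφ] at h
  simp only [map_one, one_mul, one_pow] at h
  exact_mod_cast h.symm

end Symbol

/-! ### The weak limit of the atomic measures and its identification with the spectral measure. -/

section LimitMeasure

variable {H : Type*} [NormedAddCommGroup H] [InnerProductSpace ℂ H] [CompleteSpace H]
  {A : H →L[ℂ] H} {φ : H} {r : ℝ} {E : EigenSystem A φ r}

/-- The atomic measure with mass `xi N n ^ 2` at each eigenvalue `lam N n` of `A_N`, as a measure on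
the circle that contains the eigenvalues. -/
noncomputable def circleMeasure (E : EigenSystem A φ r) (h : ∀ N n, ‖E.lam N n‖ = √r) (N : ℕ) :
    Measure (Metric.sphere (0 : ℂ) (√r)) :=
  ∑ n, ENNReal.ofReal (E.xi N n ^ 2) • Measure.dirac ⟨E.lam N n, by simp [h]⟩

theorem circleMeasure_preimage (h : ∀ N n, ‖E.lam N n‖ = √r) (N : ℕ) {S : Set ℂ}
    (hS : MeasurableSet S) :
    circleMeasure E h N (Subtype.val ⁻¹' S) = ENNReal.ofReal (muN E N S) := by
  have hS' : MeasurableSet ((Subtype.val : Metric.sphere (0 : ℂ) (√r) → ℂ) ⁻¹' S) :=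
    measurable_subtype_coe hS
  rw [muN, ENNReal.ofReal_sum_of_nonneg
    fun _ _ => Set.indicator_nonneg (fun _ _ => sq_nonneg _) _]
  simp only [circleMeasure, Measure.finsetSum_apply, Measure.smul_apply, smul_eq_mul,
    Measure.dirac_apply' _ hS']
  refine Finset.sum_congr rfl fun n _ => ?_
  by_cases hn : E.lam N n ∈ S <;> simp [Set.indicator, hn]

theorem isProbabilityMeasure_circleMeasure (h : ∀ N n, ‖E.lam N n‖ = √r) (hφ : ‖φ‖ = 1) (N : ℕ) :
    IsProbabilityMeasure (circleMeasure E h N) := by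
  refine ⟨?_⟩
  have h1 := circleMeasure_preimage h N MeasurableSet.univ
  rw [Set.preimage_univ] at h1
  rw [h1]
  simp [muN, sum_xi_sq E hφ]

theorem integral_circleMeasure (h : ∀ N n, ‖E.lam N n‖ = √r) (N : ℕ) (f : ℂ → ℂ) :
    ∫ z, f z ∂(circleMeasure E h N) = ∑ n, f (E.lam N n) * (E.xi N n : ℂ) ^ 2 := by
  rw [circleMeasure, integral_finsetSum_measure fun n _ =>
    (integrable_dirac (by simp)).smul_measure ENNReal.ofReal_ne_top]
  refine Finset.sum_congr rfl fun n _ => ?_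
  rw [integral_smul_measure, integral_dirac, ENNReal.toReal_ofReal (sq_nonneg _),
    Complex.real_smul, mul_comm, Complex.ofReal_pow]

/-- The properties that characterize the weak limit, along `D`, of the atomic measures
`∑ n, xi N n ^ 2 • δ (lam N n)`. -/
structure IsLimitMeasure (D : Ultrafilter ℕ) (E : EigenSystem A φ r) (ν : Measure ℂ) : Prop where
  prob : IsProbabilityMeasure ν
  norm_eq : ∀ᵐ z ∂ν, ‖z‖ = √r
  tendsto_integral : ∀ f : ℂ → ℂ, Continuous f →
    Tendsto (fun N => ∑ n, f (E.lam N n) * (E.xi N n : ℂ) ^ 2) D (𝓝 (∫ z, f z ∂ν))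
  open_le : ∀ U, IsOpen U → ν U ≤ ENNReal.ofReal (muNaive D E U)
  eq_of_null_frontier : ∀ S, MeasurableSet S → ν (frontier S) = 0 →
    ν S = ENNReal.ofReal (muNaive D E S)

/-- On the compact circle the probability measures form a compact space, so the ultrafilter has a
weak limit, which is then pushed forward to `ℂ`. The statements on open sets and on sets with null
frontier are the portmanteau theorem, since the atomic masses of a measurable set converge along `D`
to its naive measure. -/
theorem exists_isLimitMeasure (h : ∀ N n, ‖E.lam N n‖ = √r) (hφ : ‖φ‖ = 1) (D : Ultrafilter ℕ) :
    ∃ ν, IsLimitMeasure D E ν := by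
  let κ : ℕ → ProbabilityMeasure (Metric.sphere (0 : ℂ) (√r)) := fun N =>
    ⟨circleMeasure E h N, isProbabilityMeasure_circleMeasure h hφ N⟩
  obtain ⟨ν₀, -, hν₀⟩ := isCompact_univ.ultrafilter_le_nhds (D.map κ) (by simp)
  have hlim : Tendsto κ D (𝓝 ν₀) := hν₀
  have emb : MeasurableEmbedding (Subtype.val : Metric.sphere (0 : ℂ) (√r) → ℂ) :=
    MeasurableEmbedding.subtype_coe Metric.isClosed_sphere.measurableSet
  have hmap : ∀ S, (ν₀ : Measure (Metric.sphere (0 : ℂ) (√r))).map Subtype.val S =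
      (ν₀ : Measure (Metric.sphere (0 : ℂ) (√r))) (Subtype.val ⁻¹' S) := fun S => emb.map_apply _ S
  have hnaive : ∀ S, MeasurableSet S →
      Tendsto (fun N => (κ N : Measure (Metric.sphere (0 : ℂ) (√r))) (Subtype.val ⁻¹' S)) D
        (𝓝 (ENNReal.ofReal (muNaive D E S))) := fun S hS => by
    refine (ENNReal.tendsto_ofReal (tendsto_muN D E S)).congr fun N => ?_
    exact (circleMeasure_preimage h N hS).symm
  refine ⟨(ν₀ : Measure (Metric.sphere (0 : ℂ) (√r))).map Subtype.val,
    Measure.isProbabilityMeasure_map measurable_subtype_coe.aemeasurable, ?_, ?_, ?_, ?_⟩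
  · rw [emb.ae_map_iff]
    exact Eventually.of_forall fun z => by simp
  · intro f hf
    rw [emb.integral_map]
    have h1 := (ProbabilityMeasure.tendsto_iff_forall_integral_rclike_tendsto ℂ).1 hlim
      (BoundedContinuousFunction.mkOfCompact ⟨_, hf.comp continuous_subtype_val⟩)
    exact h1.congr fun N => integral_circleMeasure h N f
  · intro U hU
    rw [hmap]
    refine (ProbabilityMeasure.le_liminf_measure_open_of_tendsto hlim
      (hU.preimage continuous_subtype_val)).trans (hnaive U hU.measurableSet).liminf_eq.le
  · intro S hS hS0
    rw [hmap] at hS0 ⊢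
    have h0 := measure_mono_null (continuous_subtype_val.frontier_preimage_subset S) hS0
    exact tendsto_nhds_unique
      (ProbabilityMeasure.tendsto_measure_of_null_frontier_of_tendsto' hlim h0) (hnaive S hS)

variable {D : Ultrafilter ℕ} {ν : Measure ℂ} {M : ℕ}

theorem mem_interior_square {z : ℂ} (hz : ‖z‖ < M) : z ∈ interior (square M) := by
  refine mem_interior.2 ⟨Metric.ball 0 M, fun w hw => ?_, Metric.isOpen_ball, by simpa using hz⟩
  have hw' : ‖w‖ < M := by simpa using hw
  have h1 := abs_le.1 ((Complex.abs_re_le_norm w).trans hw'.le)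
  have h2 := abs_le.1 ((Complex.abs_im_le_norm w).trans hw'.le)
  exact ⟨h1, h2⟩

theorem IsLimitMeasure.ae_mem_interior (hν : IsLimitMeasure D E ν) (hM : √r < M) :
    ∀ᵐ z ∂ν, z ∈ interior (square M) := by
  filter_upwards [hν.norm_eq] with z hz
  exact mem_interior_square (hz ▸ hM)

/-- The nice strips are cut out of the closed square and need not be open. As `ν` lives in the
interior of the square, intersecting with that interior loses no mass and yields an open set, to
which `open_le` applies. -/
theorem IsLimitMeasure.null_of_open_inter_square (hν : IsLimitMeasure D E ν) (hM : √r < M)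
    {L : Set ℂ} (h : ∀ δ > 0, ∃ V : Set ℂ, IsOpen V ∧ L ⊆ V ∧ muNaive D E (square M ∩ V) < δ) :
    ν L = 0 := by
  refine nonpos_iff_eq_zero.1 (ENNReal.le_of_forall_pos_le_add fun δ hδ _ => ?_)
  obtain ⟨V, hV, hLV, hlt⟩ := h δ hδ
  rw [zero_add]
  calc ν L ≤ ν (interior (square M) ∩ V) := by
        refine measure_mono_ae ?_
        filter_upwards [hν.ae_mem_interior hM] with z hz hzL
        exact ⟨hz, hLV hzL⟩
    _ ≤ ENNReal.ofReal (muNaive D E (interior (square M) ∩ V)) :=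
        hν.open_le _ (isOpen_interior.inter hV)
    _ ≤ ENNReal.ofReal δ := ENNReal.ofReal_le_ofReal
        ((muNaive_mono D E (Set.inter_subset_inter_left _ interior_subset)).trans hlt.le)
    _ = δ := ENNReal.ofReal_coe_nnreal

theorem IsLimitMeasure.null_re (hν : IsLimitMeasure D E ν) (hM : √r < M) {t : ℝ}
    (h : ∀ δ > 0, ∃ ε > 0, muNaive D E (stripRe M t ε) < δ) : ν {z | z.re = t} = 0 := by
  refine hν.null_of_open_inter_square hM fun δ hδ => ?_
  obtain ⟨ε, hε, hlt⟩ := h δ hδ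
  refine ⟨{z | |z.re - t| < ε}, isOpen_lt (by fun_prop) continuous_const, fun z hz => ?_, hlt⟩
  have hz' : z.re = t := hz
  simpa [hz'] using hε

theorem IsLimitMeasure.null_im (hν : IsLimitMeasure D E ν) (hM : √r < M) {t : ℝ}
    (h : ∀ δ > 0, ∃ ε > 0, muNaive D E (stripIm M t ε) < δ) : ν {z | z.im = t} = 0 := by
  refine hν.null_of_open_inter_square hM fun δ hδ => ?_
  obtain ⟨ε, hε, hlt⟩ := h δ hδ
  refine ⟨{z | |z.im - t| < ε}, isOpen_lt (by fun_prop) continuous_const, fun z hz => ?_, hlt⟩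
  have hz' : z.im = t := hz
  simpa [hz'] using hε

theorem openRect_eq_reProdIm {a b c d : ℝ} (ha : a ∈ Set.Icc (-M : ℝ) M)
    (hb : b ∈ Set.Icc (-M : ℝ) M) (hc : c ∈ Set.Icc (-M : ℝ) M) (hd : d ∈ Set.Icc (-M : ℝ) M) :
    openRect M a b c d = Set.Ioo a b ×ℂ Set.Ioo c d := by
  ext z
  refine ⟨fun h => h.2, fun h => ⟨⟨?_, ?_⟩, h⟩⟩
  · exact ⟨ha.1.trans h.1.1.le, h.1.2.le.trans hb.2⟩
  · exact ⟨hc.1.trans h.2.1.le, h.2.2.le.trans hd.2⟩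

theorem frontier_Ioo_subset_pair (a b : ℝ) : frontier (Set.Ioo a b) ⊆ {a, b} := by
  rcases lt_or_ge a b with h | h
  · rw [frontier_Ioo h]
  · simp [Set.Ioo_eq_empty (not_lt.2 h)]

theorem isOpen_openRect {a b c d : ℝ} (ha : a ∈ Set.Icc (-M : ℝ) M)
    (hb : b ∈ Set.Icc (-M : ℝ) M) (hc : c ∈ Set.Icc (-M : ℝ) M) (hd : d ∈ Set.Icc (-M : ℝ) M) :
    IsOpen (openRect M a b c d) := by
  rw [openRect_eq_reProdIm ha hb hc hd]
  exact isOpen_Ioo.reProdIm isOpen_Ioo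

/-- The naive measure of a rectangle in `S` agrees with the limit measure, if the sides of the
rectangle are null sets. -/
theorem IsLimitMeasure.openRect_eq (hν : IsLimitMeasure D E ν)
    {a b c d : ℝ} (ha : a ∈ Set.Icc (-M : ℝ) M)
    (hb : b ∈ Set.Icc (-M : ℝ) M) (hc : c ∈ Set.Icc (-M : ℝ) M) (hd : d ∈ Set.Icc (-M : ℝ) M)
    (ha0 : ν {z | z.re = a} = 0) (hb0 : ν {z | z.re = b} = 0)
    (hc0 : ν {z | z.im = c} = 0) (hd0 : ν {z | z.im = d} = 0) :
    ν (openRect M a b c d) = ENNReal.ofReal (muNaive D E (openRect M a b c d)) := by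
  refine hν.eq_of_null_frontier _ (isOpen_openRect ha hb hc hd).measurableSet ?_
  rw [openRect_eq_reProdIm ha hb hc hd, Complex.frontier_reProdIm]
  refine measure_mono_null (t := ({z | z.im = c} ∪ {z | z.im = d}) ∪
    ({z | z.re = a} ∪ {z | z.re = b})) (Set.union_subset_union ?_ ?_) ?_
  · exact fun z hz => frontier_Ioo_subset_pair c d hz.2
  · exact fun z hz => frontier_Ioo_subset_pair a b hz.1
  · exact measure_union_null (measure_union_null hc0 hd0) (measure_union_null ha0 hb0)

/-- Agreement on rectangles only gives `ν ≤ μ`, because `μ` comes from the largest outer measure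
bounded by the naive measure on `Sq*`. Equality follows since both have total mass `1`. -/
theorem IsLimitMeasure.eq_spectralMeasure (hν : IsLimitMeasure D E ν) (hM : √r < M)
    (hφ : ‖φ‖ = 1) (NI : NiceSet D E M) : spectralMeasure NI = ν := by
  have := hν.prob
  have hrect : ∀ X ∈ sqStar NI, ν X = ENNReal.ofReal (muNaive D E X) := by
    rintro X ⟨a, ha, b, hb, c, hc, d, hd, rfl⟩
    have re0 : ∀ t ∈ NI.carrier, ν {z | z.re = t} = 0 := fun t ht =>
      hν.null_re hM fun δ hδ => by
        obtain ⟨ε, hε, h1, -⟩ := NI.nice t ht δ hδ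
        exact ⟨ε, hε, h1⟩
    have im0 : ∀ t ∈ NI.carrier, ν {z | z.im = t} = 0 := fun t ht =>
      hν.null_im hM fun δ hδ => by
        obtain ⟨ε, hε, -, h1⟩ := NI.nice t ht δ hδ
        exact ⟨ε, hε, h1⟩
    exact hν.openRect_eq (NI.subset ha) (NI.subset hb) (NI.subset hc) (NI.subset hd)
      (re0 a ha) (re0 b hb) (im0 c hc) (im0 d hd)
  have hle : ν.toOuterMeasure ≤ OuterMeasure.boundedBy
      fun X => ⨅ _ : X ∈ sqStar NI, ENNReal.ofReal (muNaive D E X) := by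
    rw [OuterMeasure.le_boundedBy]
    exact fun X => le_iInf fun hX => (hrect X hX).le
  have happly : ∀ Y, MeasurableSet Y → spectralMeasure NI Y = muStar NI Y := fun Y hY =>
    toMeasure_apply _ _ hY
  have hle' : ν ≤ spectralMeasure NI := by
    refine Measure.le_iff.2 fun Y hY => ?_
    rw [happly Y hY, muStar, OuterMeasure.restrict_apply]
    refine le_trans (measure_mono_ae ?_) (hle _)
    filter_upwards [hν.ae_mem_interior hM] with z hz hzY
    exact ⟨hzY, hz⟩
  -- The rectangle with all sides at `±M` is in `Sq*` and covers the interior of `S` alone.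
  have htop : spectralMeasure NI Set.univ ≤ 1 := by
    rw [happly _ MeasurableSet.univ]
    refine (muStar_le NI NI.left_mem NI.right_mem NI.left_mem NI.right_mem (Y := Set.univ)
      ?_).trans ?_
    · rintro z ⟨-, hz⟩
      exact ⟨interior_subset hz, interior_square hz⟩
    · rw [ENNReal.ofReal_le_one]
      refine le_of_tendsto' (tendsto_muN D E _) fun N => (muN_le E N _).trans ?_
      simp [hφ]
  have hprob : IsProbabilityMeasure (spectralMeasure NI) :=
    ⟨le_antisymm htop (by simpa using hle' Set.univ)⟩
  exact (Measure.eq_of_le_of_isProbabilityMeasure hle').symm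

end LimitMeasure

/-! ### Polynomial approximation, and the support of the limit measure. -/

section Approximation

/-- Stone–Weierstrass on a compact set of complex numbers, for polynomials in `z` and `conj z`. -/
theorem exists_polyFun_close {s : Set ℂ} (hs : IsCompact s) {f : ℂ → ℂ} (hf : Continuous f)
    {ε : ℝ} (hε : 0 < ε) : ∃ P : MvPolynomial (Fin 2) ℂ, ∀ z ∈ s, ‖f z - polyFun P z‖ < ε := by
  have : CompactSpace s := isCompact_iff_compactSpace.1 hs
  let Φ : MvPolynomial (Fin 2) ℂ →ₐ[ℂ] C(s, ℂ) := MvPolynomial.aeval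
    ![ContinuousMap.restrict s (ContinuousMap.id ℂ),
      star (ContinuousMap.restrict s (ContinuousMap.id ℂ))]
  have hΦ : ∀ P (z : s), Φ P z = polyFun P z := by
    intro P z
    induction P using MvPolynomial.induction_on with
    | C a => simp [Φ, polyFun]
    | add p q hp hq => simp [polyFun] at hp hq ⊢; rw [hp, hq]
    | mul_X p i hp =>
      simp only [polyFun, map_mul, ContinuousMap.mul_apply] at hp ⊢
      rw [hp]
      fin_cases i <;> simp [Φ]
  have hmem : ∀ g : C(s, ℂ), g ∈ Φ.range.topologicalClosure := by
    intro g
    induction g using ContinuousMap.induction_on_of_compact with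
    | const c => exact Subalgebra.algebraMap_mem _ c
    | id => exact subset_closure ⟨MvPolynomial.X 0, by simp [Φ]⟩
    | star_id => exact subset_closure ⟨MvPolynomial.X 1, by simp [Φ]⟩
    | add f g hf hg => exact add_mem hf hg
    | mul f g hf hg => exact mul_mem hf hg
    | frequently f hf =>
      have h := mem_closure_iff_frequently.2 hf
      exact (Subalgebra.isClosed_topologicalClosure Φ.range).closure_subset h
  obtain ⟨-, ⟨P, rfl⟩, hP⟩ := Metric.mem_closure_iff.1
    (hmem ⟨fun z : s => f z, hf.comp continuous_subtype_val⟩) ε hε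
  refine ⟨P, fun z hz => ?_⟩
  have h := (ContinuousMap.dist_apply_le_dist ⟨z, hz⟩).trans_lt hP
  rw [dist_eq_norm] at h
  have h2 := hΦ P ⟨z, hz⟩
  change ‖f z - Φ P ⟨z, hz⟩‖ < ε at h
  rwa [h2] at h

theorem exists_bddBelow_of_notMem_spectrum {V : Type*} [NormedAddCommGroup V]
    [NormedSpace ℂ V] {A : V →L[ℂ] V} {z₀ : ℂ} (h : z₀ ∉ spectrum ℂ A) :
    ∃ c > 0, ∀ v, c * ‖v‖ ≤ ‖A v - z₀ • v‖ := by
  rw [spectrum.notMem_iff] at h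
  obtain ⟨T, hT⟩ := h
  have hinv : ∀ v, (↑T⁻¹ : V →L[ℂ] V) (z₀ • v - A v) = v := by
    intro v
    have h1 : (T : V →L[ℂ] V) v = z₀ • v - A v := by
      rw [hT]
      simp [Algebra.algebraMap_eq_smul_one]
    rw [← h1, ← mul_apply_eq_comp, Units.inv_mul, one_apply_eq_self]
  -- The `+ 1` keeps the constant positive when `V` is trivial and the inverse has norm `0`.
  refine ⟨(‖(↑T⁻¹ : V →L[ℂ] V)‖ + 1)⁻¹, by positivity, fun v => ?_⟩
  rw [inv_mul_le_iff₀ (by positivity), norm_sub_rev]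
  calc ‖v‖ = ‖(↑T⁻¹ : V →L[ℂ] V) (z₀ • v - A v)‖ := by rw [hinv]
    _ ≤ ‖(↑T⁻¹ : V →L[ℂ] V)‖ * ‖z₀ • v - A v‖ := ContinuousLinearMap.le_opNorm _ _
    _ ≤ _ := by gcongr; linarith

variable {H : Type*} [NormedAddCommGroup H] [InnerProductSpace ℂ H] [CompleteSpace H]
  {A : H →L[ℂ] H} {φ : H} {r : ℝ} {E : EigenSystem A φ r} {D : Ultrafilter ℕ} {ν : Measure ℂ}

theorem IsLimitMeasure.inner_eq_integral (hν : IsLimitMeasure D E ν) (hD : (D : Filter ℕ) ≤ atTop)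
    {ψ ψ' : H} {f f' : ℂ → ℂ} (h : HasSymbol E ψ f) (h' : HasSymbol E ψ' f') (hf : Continuous f)
    (hf' : Continuous f') : inner ℂ ψ ψ' = ∫ z, (starRingEnd ℂ) (f z) * f' z ∂ν := by
  refine tendsto_nhds_unique (tendsto_const_nhds.congr' ?_)
    (hν.tendsto_integral (fun z => (starRingEnd ℂ) (f z) * f' z) (by fun_prop))
  filter_upwards [hD h, hD h'] with N hN hN'
  exact inner_eq_sum hN.1 hN.2 hN'.2

theorem IsLimitMeasure.norm_sq_eq_integral (hν : IsLimitMeasure D E ν)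
    (hD : (D : Filter ℕ) ≤ atTop) {ψ : H} {f : ℂ → ℂ} (h : HasSymbol E ψ f) (hf : Continuous f) :
    ‖ψ‖ ^ 2 = ∫ z, ‖f z‖ ^ 2 ∂ν := by
  have h1 := hν.inner_eq_integral hD h h hf hf
  have h2 : (fun z => (starRingEnd ℂ) (f z) * f z) = fun z => ((‖f z‖ ^ 2 : ℝ) : ℂ) := by
    funext z
    rw [← Complex.normSq_eq_conj_mul_self, Complex.normSq_eq_norm_sq]
  have h3 : ∫ z, ((‖f z‖ ^ 2 : ℝ) : ℂ) ∂ν = ((∫ z, ‖f z‖ ^ 2 ∂ν : ℝ) : ℂ) := integral_ofReal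
  rw [h2, h3, inner_self_eq_norm_sq_to_K] at h1
  refine Complex.ofReal_injective ?_
  rw [Complex.ofReal_pow]
  exact h1

theorem IsLimitMeasure.exists_bound (hν : IsLimitMeasure D E ν) {f : ℂ → ℂ} (hf : Continuous f) :
    ∃ C, ∀ᵐ z ∂ν, ‖f z‖ ≤ C := by
  obtain ⟨C, hC⟩ := (isCompact_sphere (0 : ℂ) (√r)).exists_bound_of_continuousOn hf.continuousOn
  refine ⟨C, ?_⟩
  filter_upwards [hν.norm_eq] with z hz
  exact hC z (by simpa using hz)

theorem IsLimitMeasure.integrable {F : Type*} [NormedAddCommGroup F] (hν : IsLimitMeasure D E ν)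
    {f : ℂ → F} (hf : Continuous f) [SecondCountableTopologyEither ℂ F] : Integrable f ν := by
  have := hν.prob
  obtain ⟨C, hC⟩ := (isCompact_sphere (0 : ℂ) (√r)).exists_bound_of_continuousOn hf.continuousOn
  refine Integrable.of_bound hf.aestronglyMeasurable C ?_
  filter_upwards [hν.norm_eq] with z hz
  exact hC z (by simpa using hz)

/-- If `‖(A - z₀) v‖ ≥ c ‖v‖` for all `v`, the same inequality holds for the multiplication with
`z - z₀` on continuous functions. -/
theorem IsLimitMeasure.le_integral_of_bddBelow (hν : IsLimitMeasure D E ν)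
    (hD : (D : Filter ℕ) ≤ atTop) (hr : 0 < r) (hA : star A * A = (r : ℂ) • (1 : H →L[ℂ] H))
    (hA' : A * star A = (r : ℂ) • (1 : H →L[ℂ] H)) {z₀ : ℂ} {c : ℝ} (hc : 0 ≤ c)
    (h : ∀ v, c * ‖v‖ ≤ ‖A v - z₀ • v‖) {f : ℂ → ℂ} (hf : Continuous f) :
    0 ≤ ∫ z, (‖z - z₀‖ ^ 2 - c ^ 2) * ‖f z‖ ^ 2 ∂ν := by
  have := hν.prob
  choose P hP using fun k : ℕ => exists_polyFun_close (isCompact_sphere (0 : ℂ) (√r)) hf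
    (Nat.one_div_pos_of_nat (α := ℝ) (n := k))
  obtain ⟨C, hC⟩ := hν.exists_bound hf
  obtain ⟨C', hC'⟩ := hν.exists_bound
    (f := fun z => ((‖z - z₀‖ ^ 2 - c ^ 2 : ℝ) : ℂ)) (by fun_prop)
  -- For a polynomial the integral is `‖(A - z₀) v‖² - c² ‖v‖²` with `v = P(A, A*) φ`. The
  -- continuous case follows by uniform approximation on the circle and dominated convergence.
  have hpoly : ∀ k, 0 ≤ ∫ z, (‖z - z₀‖ ^ 2 - c ^ 2) * ‖polyFun (P k) z‖ ^ 2 ∂ν := by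
    intro k
    have hs := hasSymbol_polyOp (E := E) hr hA hA' (P k)
    have hcont := continuous_polyFun (P k)
    have h1 := hν.norm_sq_eq_integral hD hs hcont
    have h2 := hν.norm_sq_eq_integral hD ((hs.map hr hA).sub (hs.smul z₀)) (by fun_prop)
    have h3 := pow_le_pow_left₀ (by positivity) (h (polyOp A (P k) φ)) 2
    rw [mul_pow, h1, h2, ← integral_const_mul, ← sub_nonneg, ← integral_sub] at h3
    · refine h3.trans_eq (integral_congr_ae (Eventually.of_forall fun z => ?_))
      change ‖z * polyFun (P k) z - z₀ * polyFun (P k) z‖ ^ 2 - c ^ 2 * ‖polyFun (P k) z‖ ^ 2 = _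
      rw [← sub_mul, norm_mul]
      ring
    · exact hν.integrable (by fun_prop)
    · exact hν.integrable (by fun_prop)
  refine ge_of_tendsto' (tendsto_integral_of_dominated_convergence
    (F := fun k z => (‖z - z₀‖ ^ 2 - c ^ 2) * ‖polyFun (P k) z‖ ^ 2)
    (fun _ => C' * (C + 1) ^ 2) (fun k => ?_) (integrable_const _) (fun k => ?_) ?_) hpoly
  · have hcont := continuous_polyFun (P k)
    exact (by fun_prop : Continuous _).aestronglyMeasurable
  · filter_upwards [hν.norm_eq, hC, hC'] with z hz h1 h2
    have h3 := hP k z (by simpa using hz)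
    have h4 : 1 / ((k : ℝ) + 1) ≤ 1 := by
      rw [div_le_one (by positivity)]
      linarith [k.cast_nonneg (α := ℝ)]
    have h5 : ‖polyFun (P k) z‖ ≤ C + 1 := by
      have := norm_sub_norm_le (polyFun (P k) z) (f z)
      rw [norm_sub_rev] at this
      linarith
    rw [Complex.norm_real] at h2
    rw [norm_mul, norm_pow, norm_norm]
    exact mul_le_mul h2 (pow_le_pow_left₀ (norm_nonneg _) h5 2) (by positivity)
      ((norm_nonneg _).trans h2)
  · filter_upwards [hν.norm_eq] with z hz
    have h1 : Tendsto (fun k => polyFun (P k) z) atTop (𝓝 (f z)) := by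
      rw [tendsto_iff_norm_sub_tendsto_zero]
      refine squeeze_zero (fun _ => norm_nonneg _) (fun k => ?_)
        tendsto_one_div_add_atTop_nhds_zero_nat
      rw [norm_sub_rev]
      exact (hP k z (by simpa using hz)).le
    exact (h1.norm.pow 2).const_mul _

/-- Off the spectrum `A - z₀` is bounded below by some `c > 0`. Testing the resulting integral
inequality with a bump supported in the ball of radius `c` around `z₀` makes the integrand
nonpositive, and negative inside the ball, so the ball is a null set. -/
theorem IsLimitMeasure.ae_mem_spectrum (hν : IsLimitMeasure D E ν)
    (hD : (D : Filter ℕ) ≤ atTop) (hr : 0 < r) (hA : star A * A = (r : ℂ) • (1 : H →L[ℂ] H))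
    (hA' : A * star A = (r : ℂ) • (1 : H →L[ℂ] H)) : ∀ᵐ z ∂ν, z ∈ spectrum ℂ A := by
  have := hν.prob
  -- `ℂ` is second countable, so a null neighbourhood of each point off the spectrum suffices.
  refine measure_null_of_locally_null _ fun z₀ hz₀ => ?_
  obtain ⟨c, hc, hb⟩ := exists_bddBelow_of_notMem_spectrum (A := A) hz₀
  refine ⟨Metric.ball z₀ c, mem_nhdsWithin_of_mem_nhds (Metric.ball_mem_nhds _ hc), ?_⟩
  have hf : Continuous fun z : ℂ => ((max 0 (c - ‖z - z₀‖) : ℝ) : ℂ) := by fun_prop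
  have h1 := hν.le_integral_of_bddBelow hD hr hA hA' hc.le hb hf
  have hneg : ∀ z : ℂ, (‖z - z₀‖ ^ 2 - c ^ 2) * ‖((max 0 (c - ‖z - z₀‖) : ℝ) : ℂ)‖ ^ 2 ≤ 0 := by
    intro z
    rcases le_total c ‖z - z₀‖ with h | h
    · simp [max_eq_left (sub_nonpos.2 h)]
    · exact mul_nonpos_of_nonpos_of_nonneg
        (sub_nonpos.2 (pow_le_pow_left₀ (norm_nonneg _) h 2)) (sq_nonneg _)
  have h2 : ∫ z, -((‖z - z₀‖ ^ 2 - c ^ 2) * ‖((max 0 (c - ‖z - z₀‖) : ℝ) : ℂ)‖ ^ 2) ∂ν = 0 := by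
    refine le_antisymm ?_ (integral_nonneg fun z => neg_nonneg.2 (hneg z))
    rw [integral_neg]
    linarith
  rw [integral_eq_zero_iff_of_nonneg (fun z => neg_nonneg.2 (hneg z))
    (hν.integrable (by fun_prop : Continuous fun z : ℂ =>
      (‖z - z₀‖ ^ 2 - c ^ 2) * ‖((max 0 (c - ‖z - z₀‖) : ℝ) : ℂ)‖ ^ 2)).neg] at h2
  refine measure_mono_null (fun z hz => ?_) h2
  have hz' : ‖z - z₀‖ < c := by simpa [dist_eq_norm] using hz
  have h3 : ‖z - z₀‖ ^ 2 < c ^ 2 := pow_lt_pow_left₀ hz' (norm_nonneg _) two_ne_zero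
  have h4 : (0 : ℝ) < max 0 (c - ‖z - z₀‖) := lt_max_of_lt_right (sub_pos.2 hz')
  have h5 : ‖((max 0 (c - ‖z - z₀‖) : ℝ) : ℂ)‖ ^ 2 ≠ 0 := by
    rw [Complex.norm_real, Real.norm_of_nonneg h4.le]
    positivity
  exact neg_ne_zero.2 (mul_ne_zero (sub_neg.2 h3).ne h5)

/-- For a normal operator the orthogonal complement of the range is the kernel. Bounded below means
trivial kernel, hence dense range, and also closed range. -/
theorem isUnit_of_bddBelow_of_isStarNormal {T : H →L[ℂ] H} (hT : IsStarNormal T) {c : ℝ}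
    (hc : 0 < c) (h : ∀ v, c * ‖v‖ ≤ ‖T v‖) : IsUnit T := by
  have hanti : AntilipschitzWith c.toNNReal⁻¹ T := by
    refine T.antilipschitz_of_bound fun v => ?_
    rw [NNReal.coe_inv, Real.coe_toNNReal c hc.le, inv_mul_eq_div, le_div_iff₀ hc, mul_comm]
    exact h v
  rw [ContinuousLinearMap.isUnit_iff_bijective,
    ContinuousLinearMap.bijective_iff_dense_range_and_antilipschitz]
  refine ⟨?_, _, hanti⟩
  rw [Submodule.topologicalClosure_eq_top_iff, ContinuousLinearMap.IsStarNormal.orthogonal_range hT]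
  exact LinearMap.ker_eq_bot.2 hanti.injective

/-- If the ball were null, then `‖z - α‖ ≥ ε` almost everywhere, so `‖(A - α) v‖ ≥ ε ‖v‖` on the
polynomial vectors and, by cyclicity, everywhere. The normal operator `A - α` would be invertible.
-/
theorem IsLimitMeasure.ball_ne_zero (hν : IsLimitMeasure D E ν)
    (hD : (D : Filter ℕ) ≤ atTop) (hr : 0 < r) (hA : star A * A = (r : ℂ) • (1 : H →L[ℂ] H))
    (hA' : A * star A = (r : ℂ) • (1 : H →L[ℂ] H)) (hcyc : IsCyclicVector A φ) {α : ℂ}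
    (hα : α ∈ spectrum ℂ A) {ε : ℝ} (hε : 0 < ε) : ν (Metric.ball α ε) ≠ 0 := by
  intro h0
  have := hν.prob
  have hb : ∀ v, ε * ‖v‖ ≤ ‖A v - α • v‖ := by
    refine hcyc.induction ?_ ?_
    · rintro _ ⟨P, rfl⟩
      have hs := hasSymbol_polyOp (E := E) hr hA hA' P
      have hcont := continuous_polyFun P
      have h1 := hν.norm_sq_eq_integral hD hs hcont
      have h2 := hν.norm_sq_eq_integral hD ((hs.map hr hA).sub (hs.smul α)) (by fun_prop)
      refine le_of_sq_le_sq ?_ (norm_nonneg _)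
      rw [mul_pow, h1, h2, ← integral_const_mul]
      refine integral_mono_ae (hν.integrable (by fun_prop)) (hν.integrable (by fun_prop)) ?_
      have hae : ∀ᵐ z ∂ν, z ∉ Metric.ball α ε := measure_eq_zero_iff_ae_notMem.1 h0
      filter_upwards [hae] with z hz
      rw [← sub_mul, norm_mul, mul_pow]
      have hz' : ε ≤ ‖z - α‖ := by simpa [dist_eq_norm] using hz
      gcongr
    · exact isClosed_le (by fun_prop) (by fun_prop)
  have hn : IsStarNormal (A - algebraMap ℂ (H →L[ℂ] H) α) := by
    refine ⟨?_⟩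
    have : Commute (star A) A := hA.trans hA'.symm
    rw [star_sub, ← algebraMap_star_comm]
    exact (this.sub_left (Algebra.commutes _ _)).sub_right
      (Commute.sub_left (Algebra.commutes _ _).symm (Algebra.commutes _ _))
  have hu := isUnit_of_bddBelow_of_isStarNormal hn hε fun v => by
    simpa [Algebra.algebraMap_eq_smul_one] using hb v
  exact hα (by simpa [spectrum.mem_resolventSet_iff] using hu.neg)

end Approximation

/-! ### Spectral projections of `φ` as limits of polynomial vectors. -/

section Window

variable {H : Type*} [NormedAddCommGroup H] [InnerProductSpace ℂ H] [CompleteSpace H]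
  {A : H →L[ℂ] H} {φ : H} {r : ℝ} {D : Ultrafilter ℕ} {ν : Measure ℂ}

open Classical in
/-- The image of `φ` under the spectral projection of `A_N` that belongs to the set `S`. -/
noncomputable def windowVec (E : EigenSystem A φ r) (S : Set ℂ) (N : ℕ) : subN A φ N :=
  ∑ k with E.lam N k ∈ S, (E.xi N k : ℂ) • E.u N k

variable {E : EigenSystem A φ r} {S : Set ℂ} {N : ℕ}

theorem inner_u_windowVec (n : Fin (Module.finrank ℂ (subN A φ N))) :
    inner ℂ (E.u N n : H) (windowVec E S N : H) =
      S.indicator (fun _ => (1 : ℂ)) (E.lam N n) * E.xi N n := by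
  classical
  rw [← Submodule.coe_inner, windowVec, inner_sum]
  simp only [inner_smul_right, orthonormal_iff_ite.1 (E.u N).orthonormal]
  by_cases hn : E.lam N n ∈ S <;> simp [hn]

theorem norm_windowVec_sq : ‖windowVec E S N‖ ^ 2 = muN E N S := by
  have h := inner_eq_sum (E := E) (f := S.indicator fun _ => 1) (f' := S.indicator fun _ => 1)
    (windowVec E S N).2 inner_u_windowVec inner_u_windowVec
  refine Complex.ofReal_injective ?_
  rw [Complex.ofReal_pow]
  refine Eq.trans ?_ ((inner_self_eq_norm_sq_to_K (𝕜 := ℂ) (windowVec E S N : H)).symm.trans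
    (h.trans ?_))
  · rfl
  · rw [muN, Complex.ofReal_sum]
    refine Finset.sum_congr rfl fun n _ => ?_
    by_cases hn : E.lam N n ∈ S <;> simp [hn]

theorem windowVec_mem_bdd (E : EigenSystem A φ r) (S : Set ℂ) (D : Ultrafilter ℕ) :
    windowVec E S ∈ bddSubmodule D fun N => subN A φ N := by
  refine ⟨‖φ‖, Eventually.of_forall fun N => le_of_sq_le_sq ?_ (norm_nonneg _)⟩
  rw [norm_windowVec_sq]
  exact muN_le E N S

theorem averageVec_eq (E : EigenSystem A φ r) (M : ℕ) (s : ℕ → ℕ → ℝ) (p : ℕ) (α : ℂ) (N : ℕ) :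
    averageVec E M s p α N =
      (((muN E N (boxAt M s p α))⁻¹ : ℝ) : ℂ) • windowVec E (boxAt M s p α) N := by
  rw [averageVec, windowVec, Finset.smul_sum]
  refine Finset.sum_congr rfl fun n _ => ?_
  rw [smul_smul, div_eq_inv_mul, Complex.ofReal_mul]

/-- The averaging vectors represent a multiple of the class of the window vectors. -/
theorem averageVec_cls (M : ℕ) (s : ℕ → ℕ → ℝ) (p : ℕ) (α : ℂ)
    (h : muNaive D E (boxAt M s p α) ≠ 0) :
    ∃ hu : averageVec E M s p α ∈ bddSubmodule D fun N => subN A φ N,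
      cls (averageVec E M s p α) hu = (((muNaive D E (boxAt M s p α))⁻¹ : ℝ) : ℂ) •
        cls (windowVec E (boxAt M s p α)) (windowVec_mem_bdd E _ D) := by
  set S := boxAt M s p α with hS
  -- The limit is nonzero, so the inverses converge and the value `0⁻¹ = 0` can occur only off a set
  -- in `D`.
  have hlim : Tendsto (fun N => (muN E N S)⁻¹) D (𝓝 (muNaive D E S)⁻¹) :=
    (tendsto_muN D E S).inv₀ h
  obtain ⟨C, hC⟩ := windowVec_mem_bdd E S D
  have hu : averageVec E M s p α ∈ bddSubmodule D fun N => subN A φ N := by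
    refine ⟨(|(muNaive D E S)⁻¹| + 1) * C, ?_⟩
    filter_upwards [hC, hlim.abs.eventually_lt_const (lt_add_one _)] with N h1 h2
    rw [averageVec_eq, norm_smul, Complex.norm_real, Real.norm_eq_abs]
    exact mul_le_mul h2.le h1 (norm_nonneg _) (by positivity)
  refine ⟨hu, ?_⟩
  have hsm := (bddSubmodule D fun N => subN A φ N).smul_mem (((muNaive D E S)⁻¹ : ℝ) : ℂ)
    (windowVec_mem_bdd E S D)
  have e : (((muNaive D E S)⁻¹ : ℝ) : ℂ) • cls (windowVec E S) (windowVec_mem_bdd E S D) =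
      cls ((((muNaive D E S)⁻¹ : ℝ) : ℂ) • windowVec E S) hsm :=
    ((SeparationQuotient.mkCLM ℂ (BddSeq D fun N => subN A φ N)).map_smul _ _).symm
  rw [e, cls_eq_iff]
  have h0 : Tendsto (fun N => |(muN E N S)⁻¹ - (muNaive D E S)⁻¹| * C) D (𝓝 0) := by
    have := ((hlim.sub_const (muNaive D E S)⁻¹).abs).mul_const C
    simpa using this
  refine squeeze_zero' (Eventually.of_forall fun _ => norm_nonneg _) ?_ h0
  filter_upwards [hC] with N h1
  rw [averageVec_eq, Pi.smul_apply, ← sub_smul, norm_smul, ← Complex.ofReal_sub,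
    Complex.norm_real, Real.norm_eq_abs]
  exact mul_le_mul_of_nonneg_left h1 (abs_nonneg _)

/-- A window vector can be approximated by the vectors `P(A, A*) φ`, while the polynomial
functions `f_P` approximate the indicator function of the window. -/
theorem IsLimitMeasure.exists_poly_window (hν : IsLimitMeasure D E ν)
    (hD : (D : Filter ℕ) ≤ atTop) (hr : 0 < r) (hA : star A * A = (r : ℂ) • (1 : H →L[ℂ] H))
    (hA' : A * star A = (r : ℂ) • (1 : H →L[ℂ] H)) (hφ : ‖φ‖ = 1) (hS : IsOpen S)
    (hνS : ν S = ENNReal.ofReal (muNaive D E S)) {δ : ℝ} (hδ : 0 < δ) :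
    ∃ P : MvPolynomial (Fin 2) ℂ,
      (∀ᶠ N in (D : Filter ℕ), ‖(windowVec E S N : H) - polyOp A P φ‖ < δ) ∧
      ∫ z, ‖polyFun P z - S.indicator (fun _ => (1 : ℂ)) z‖ ∂ν < δ := by
  have := hν.prob
  -- Since `η ≤ 1`, the squared norm error is below `2 * η + 2 * η ^ 2 ≤ 4 * η`; the `L¹` error is
  -- below `2 * η`.
  obtain ⟨η, hη, hη1, hη2, hη3⟩ : ∃ η : ℝ, 0 < η ∧ η ≤ 1 ∧ 4 * η ≤ δ ^ 2 ∧ 2 * η < δ :=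
    ⟨min 1 (min (δ ^ 2 / 4) (δ / 4)), by positivity, min_le_left _ _, by
      have := (min_le_right 1 (min (δ ^ 2 / 4) (δ / 4))).trans (min_le_left _ _)
      linarith, by
      have := (min_le_right 1 (min (δ ^ 2 / 4) (δ / 4))).trans (min_le_right _ _)
      linarith⟩
  obtain ⟨F, hFS, hF, hlt⟩ := hS.measurableSet.exists_isClosed_sdiff_lt (μ := ν)
    (measure_ne_top ν S) (ENNReal.ofReal_pos.2 hη).ne'
  -- Urysohn: `g` lies between the indicators of `F` and of `S`, so it differs from that of `S` by
  -- less than `η` in `L¹(ν)`.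
  obtain ⟨g, hg0, hg1, hg⟩ := exists_continuous_zero_one_of_isClosed hS.isClosed_compl hF
    (Set.disjoint_left.2 fun z hz hzF => hz (hFS hzF))
  have hgc : Continuous fun z => ((g z : ℝ) : ℂ) := by fun_prop
  have hgi : Integrable (fun z => g z) ν := hν.integrable g.continuous
  have hle : ∀ z, g z ≤ S.indicator (fun _ => (1 : ℝ)) z := by
    intro z
    by_cases hz : z ∈ S
    · simpa [hz] using (hg z).2
    · simpa [hz] using (hg0 hz).le
  have hone : ∀ z, S.indicator (fun _ => (1 : ℝ)) z - g z ≤ 1 := by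
    intro z
    have := (hg z).1
    by_cases hz : z ∈ S <;> simp [hz] <;> linarith
  have hSi : Integrable (S.indicator fun _ => (1 : ℝ)) ν :=
    (integrable_const 1).indicator hS.measurableSet
  have hint : ν.real S - ∫ z, g z ∂ν < η := by
    have e1 : ν.real S = ∫ z, S.indicator (fun _ => (1 : ℝ)) z ∂ν := by
      rw [integral_indicator_const _ hS.measurableSet, smul_eq_mul, mul_one]
    rw [e1, ← integral_sub hSi hgi]
    have h1 : ∫ z, (S.indicator (fun _ => (1 : ℝ)) z - g z) ∂ν ≤
        ∫ z, (S \ F).indicator (fun _ => (1 : ℝ)) z ∂ν := by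
      refine integral_mono (hSi.sub hgi)
        ((integrable_const 1).indicator (hS.measurableSet.diff hF.measurableSet)) fun z => ?_
      by_cases hz : z ∈ S
      · by_cases hzF : z ∈ F
        · simp [hz, hzF, hg1 hzF]
        · simpa [hz, hzF] using (hg z).1
      · simp [hz, hg0 hz]
    rw [integral_indicator_const _ (hS.measurableSet.diff hF.measurableSet), smul_eq_mul,
      mul_one] at h1
    refine h1.trans_lt ?_
    rw [Measure.real]
    exact (ENNReal.lt_ofReal_iff_toReal_lt (measure_ne_top _ _)).1 hlt
  obtain ⟨P, hP⟩ := exists_polyFun_close (isCompact_sphere (0 : ℂ) (√r)) hgc hη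
  have hchi : ∀ z, S.indicator (fun _ => (1 : ℂ)) z =
      ((S.indicator (fun _ => (1 : ℝ)) z : ℝ) : ℂ) := by
    intro z
    by_cases hz : z ∈ S <;> simp [hz]
  have hdist : ∀ z, ‖z‖ = √r → ‖S.indicator (fun _ => (1 : ℂ)) z - polyFun P z‖ ≤
      (S.indicator (fun _ => (1 : ℝ)) z - g z) + η := by
    intro z hz
    have h1 := hP z (by simpa using hz)
    have h2 : ‖S.indicator (fun _ => (1 : ℂ)) z - ((g z : ℝ) : ℂ)‖ =
        S.indicator (fun _ => (1 : ℝ)) z - g z := by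
      rw [hchi, ← Complex.ofReal_sub, Complex.norm_real,
        Real.norm_of_nonneg (sub_nonneg.2 (hle z))]
    have h3 := norm_sub_le_norm_sub_add_norm_sub (S.indicator (fun _ => (1 : ℂ)) z)
      ((g z : ℝ) : ℂ) (polyFun P z)
    linarith
  refine ⟨P, ?_, ?_⟩
  -- Writing `χ` for the indicator of `S`, `0 ≤ χ - g ≤ 1` gives `(χ - g + η)² ≤ 2 (χ - g) + 2 η²`.
  -- This bound is linear in `χ` and `g`, so its weighted sums converge along `D` although `χ` is
  -- discontinuous: the sums of `χ` are `muN E N S`, and `hνS` identifies their limit with `ν S`.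
  · have hlim : Tendsto (fun N => 2 * (muN E N S - ∑ n, g (E.lam N n) * E.xi N n ^ 2) + 2 * η ^ 2)
        D (𝓝 (2 * (muNaive D E S - ∫ z, g z ∂ν) + 2 * η ^ 2)) := by
      have h1 := (Complex.continuous_re.tendsto _).comp (hν.tendsto_integral _ hgc)
      have h2 : (∫ z, ((g z : ℝ) : ℂ) ∂ν) = ((∫ z, g z ∂ν : ℝ) : ℂ) := integral_ofReal
      rw [h2, Complex.ofReal_re] at h1
      have h3 : Tendsto (fun N => ∑ n, g (E.lam N n) * E.xi N n ^ 2) D (𝓝 (∫ z, g z ∂ν)) :=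
        h1.congr fun N => by
          simp only [Function.comp_apply, ← Complex.ofReal_pow, ← Complex.ofReal_mul,
            ← Complex.ofReal_sum, Complex.ofReal_re]
      exact (((tendsto_muN D E S).sub h3).const_mul 2).add_const _
    have hval : 2 * (muNaive D E S - ∫ z, g z ∂ν) + 2 * η ^ 2 < δ ^ 2 := by
      have h1 : ν.real S = muNaive D E S := by
        rw [Measure.real, hνS, ENNReal.toReal_ofReal (muNaive_nonneg D E S)]
      nlinarith
    filter_upwards [hlim.eventually_lt_const hval, hD (hasSymbol_polyOp (E := E) hr hA hA' P)]
      with N h1 h2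
    refine lt_of_pow_lt_pow_left₀ 2 hδ.le (lt_of_le_of_lt ?_ h1)
    have h3 : ∀ n, inner ℂ (E.u N n : H) ((windowVec E S N : H) - polyOp A P φ) =
        (fun z => S.indicator (fun _ => (1 : ℂ)) z - polyFun P z) (E.lam N n) * E.xi N n := by
      intro n
      rw [inner_sub_right, inner_u_windowVec, h2.2, sub_mul]
    have h4 := inner_eq_sum (E := E) (f := fun z => S.indicator (fun _ => (1 : ℂ)) z - polyFun P z)
      (f' := fun z => S.indicator (fun _ => (1 : ℂ)) z - polyFun P z)
      (sub_mem (windowVec E S N).2 h2.1) h3 h3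
    have h5 : ‖(windowVec E S N : H) - polyOp A P φ‖ ^ 2 = ∑ n,
        ‖S.indicator (fun _ => (1 : ℂ)) (E.lam N n) - polyFun P (E.lam N n)‖ ^ 2 *
          E.xi N n ^ 2 := by
      refine Complex.ofReal_injective ?_
      rw [Complex.ofReal_pow]
      refine ((inner_self_eq_norm_sq_to_K (𝕜 := ℂ) _).symm.trans h4).trans ?_
      rw [Complex.ofReal_sum]
      refine Finset.sum_congr rfl fun n _ => ?_
      rw [← Complex.normSq_eq_conj_mul_self, Complex.normSq_eq_norm_sq]
      push_cast
      rfl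
    have h6 : 2 * (muN E N S - ∑ n, g (E.lam N n) * E.xi N n ^ 2) + 2 * η ^ 2 =
        ∑ n, (2 * (S.indicator (fun _ => (1 : ℝ)) (E.lam N n) - g (E.lam N n)) + 2 * η ^ 2) *
          E.xi N n ^ 2 := by
      have e1 : muN E N S = ∑ n, S.indicator (fun _ => (1 : ℝ)) (E.lam N n) * E.xi N n ^ 2 := by
        refine Finset.sum_congr rfl fun n _ => ?_
        by_cases hn : E.lam N n ∈ S <;> simp [hn]
      simp only [add_mul, mul_assoc, sub_mul, Finset.sum_add_distrib, ← Finset.mul_sum,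
        Finset.sum_sub_distrib, sum_xi_sq E hφ, mul_one, e1]
    rw [h5, h6]
    refine Finset.sum_le_sum fun n _ => mul_le_mul_of_nonneg_right ?_ (sq_nonneg _)
    have h7 := hdist (E.lam N n) (norm_lam hr hA n)
    have h8 := sub_nonneg.2 (hle (E.lam N n))
    have h9 := hone (E.lam N n)
    set a := S.indicator (fun _ => (1 : ℝ)) (E.lam N n) - g (E.lam N n)
    calc _ ≤ (a + η) ^ 2 := pow_le_pow_left₀ (norm_nonneg _) h7 2
      _ ≤ 2 * a ^ 2 + 2 * η ^ 2 := by nlinarith [sq_nonneg (a - η)]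
      _ ≤ 2 * a + 2 * η ^ 2 := by nlinarith
  · have h1 : ∫ z, ‖polyFun P z - S.indicator (fun _ => (1 : ℂ)) z‖ ∂ν ≤
        ∫ z, ((S.indicator (fun _ => (1 : ℝ)) z - g z) + η) ∂ν := by
      refine integral_mono_of_nonneg (Eventually.of_forall fun _ => norm_nonneg _)
        ((hSi.sub hgi).add (integrable_const η)) ?_
      filter_upwards [hν.norm_eq] with z hz
      rw [norm_sub_rev]
      exact hdist z hz
    have hSg : Integrable (fun z => S.indicator (fun _ => (1 : ℝ)) z - g z) ν := hSi.sub hgi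
    rw [integral_add hSg (integrable_const η), integral_sub hSi hgi,
      integral_indicator_const _ hS.measurableSet] at h1
    simp only [smul_eq_mul, mul_one, integral_const, probReal_univ, one_mul] at h1
    linarith

end Window

/-! ### The sesquilinear form of a bounded continuous kernel. -/

section KernelForm

variable {σ : Set ℂ} {ν : Measure ℂ} {K : ℂ → ℂ → ℂ} {C : ℝ} {f f' q q' : ℂ → ℂ}

theorem norm_kernel_integral_le (hν : ∀ᵐ z ∂ν, z ∈ σ) (hC : ∀ x ∈ σ, ∀ y ∈ σ, ‖K x y‖ ≤ C)
    (hf : Integrable f ν) {y : ℂ} (hy : y ∈ σ) : ‖∫ x, K x y * f x ∂ν‖ ≤ C * ∫ x, ‖f x‖ ∂ν := by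
  rw [← integral_const_mul]
  refine norm_integral_le_of_norm_le (hf.norm.const_mul C) ?_
  filter_upwards [hν] with x hx
  rw [norm_mul]
  exact mul_le_mul_of_nonneg_right (hC x hx y hy) (norm_nonneg _)

theorem aestronglyMeasurable_kernel (hν : ∀ᵐ z ∂ν, z ∈ σ) (hσ : MeasurableSet σ)
    (hK : ContinuousOn (Function.uncurry K) (σ ×ˢ σ)) {y : ℂ} (hy : y ∈ σ) :
    AEStronglyMeasurable (fun x => K x y) ν := by
  have h : ContinuousOn (fun x => K x y) σ :=
    hK.comp (Continuous.continuousOn (by fun_prop : Continuous fun x : ℂ => (x, y)))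
      fun x hx => ⟨hx, hy⟩
  have h2 := h.aestronglyMeasurable (μ := ν) hσ
  rwa [Measure.restrict_eq_self_of_ae_mem hν] at h2

theorem integrable_kernel (hν : ∀ᵐ z ∂ν, z ∈ σ) (hσ : MeasurableSet σ)
    (hK : ContinuousOn (Function.uncurry K) (σ ×ˢ σ)) (hC : ∀ x ∈ σ, ∀ y ∈ σ, ‖K x y‖ ≤ C)
    (hf : Integrable f ν) {y : ℂ} (hy : y ∈ σ) : Integrable (fun x => K x y * f x) ν := by
  refine hf.bdd_mul (c := C) (aestronglyMeasurable_kernel hν hσ hK hy) ?_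
  filter_upwards [hν] with x hx
  exact hC x hx y hy

/-- Nothing is known about `K` off `σ × σ`. Continuity on `σ`, which carries `ν`, is what makes the
inner integral measurable in the outer variable. -/
theorem continuousOn_kernel_integral (hν : ∀ᵐ z ∂ν, z ∈ σ) (hσ : MeasurableSet σ)
    (hK : ContinuousOn (Function.uncurry K) (σ ×ˢ σ)) (hC : ∀ x ∈ σ, ∀ y ∈ σ, ‖K x y‖ ≤ C)
    (hf : Integrable f ν) : ContinuousOn (fun y => ∫ x, K x y * f x ∂ν) σ := by
  refine continuousOn_of_dominated (bound := fun x => C * ‖f x‖)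
    (fun y hy => (integrable_kernel hν hσ hK hC hf hy).aestronglyMeasurable) (fun y hy => ?_)
    (hf.norm.const_mul C) ?_
  · filter_upwards [hν] with x hx
    rw [norm_mul]
    exact mul_le_mul_of_nonneg_right (hC x hx y hy) (norm_nonneg _)
  · filter_upwards [hν] with x hx
    exact (hK.comp (Continuous.continuousOn (by fun_prop : Continuous fun y : ℂ => (x, y)))
      fun y hy => ⟨hx, hy⟩).mul continuousOn_const

/-- The sesquilinear form with kernel `K`. -/
noncomputable def kernelForm (ν : Measure ℂ) (K : ℂ → ℂ → ℂ) (q f : ℂ → ℂ) : ℂ :=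
  ∫ y, (starRingEnd ℂ) (q y) * ∫ x, K x y * f x ∂ν ∂ν

/-- The bound involves only `L¹` norms, so approximating indicators in `L¹(ν)` will suffice. -/
theorem norm_kernelForm_le (hν : ∀ᵐ z ∂ν, z ∈ σ) (hC : ∀ x ∈ σ, ∀ y ∈ σ, ‖K x y‖ ≤ C)
    (hf : Integrable f ν) (hq : Integrable q ν) :
    ‖kernelForm ν K q f‖ ≤ (∫ y, ‖q y‖ ∂ν) * (C * ∫ x, ‖f x‖ ∂ν) := by
  rw [kernelForm, ← integral_mul_const]
  refine norm_integral_le_of_norm_le (hq.norm.mul_const _) ?_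
  filter_upwards [hν] with y hy
  rw [norm_mul, RCLike.norm_conj]
  exact mul_le_mul_of_nonneg_left (norm_kernel_integral_le hν hC hf hy) (norm_nonneg _)

theorem integrable_conj_mul_kernel (hν : ∀ᵐ z ∂ν, z ∈ σ) (hσ : MeasurableSet σ)
    (hK : ContinuousOn (Function.uncurry K) (σ ×ˢ σ)) (hC : ∀ x ∈ σ, ∀ y ∈ σ, ‖K x y‖ ≤ C)
    (hf : Integrable f ν) (hq : Integrable q ν) :
    Integrable (fun y => (starRingEnd ℂ) (q y) * ∫ x, K x y * f x ∂ν) ν := by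
  have hq' : Integrable (fun y => (starRingEnd ℂ) (q y)) ν :=
    ((RCLike.conjLIE (K := ℂ)).toContinuousLinearEquiv.toContinuousLinearMap).integrable_comp hq
  have h := (continuousOn_kernel_integral hν hσ hK hC hf).aestronglyMeasurable (μ := ν) hσ
  rw [Measure.restrict_eq_self_of_ae_mem hν] at h
  refine hq'.mul_bdd (c := C * ∫ x, ‖f x‖ ∂ν) h ?_
  filter_upwards [hν] with y hy
  exact norm_kernel_integral_le hν hC hf hy

theorem kernelForm_sub_left (hν : ∀ᵐ z ∂ν, z ∈ σ) (hσ : MeasurableSet σ)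
    (hK : ContinuousOn (Function.uncurry K) (σ ×ˢ σ)) (hC : ∀ x ∈ σ, ∀ y ∈ σ, ‖K x y‖ ≤ C)
    (hf : Integrable f ν) (hq : Integrable q ν) (hq' : Integrable q' ν) :
    kernelForm ν K (fun z => q z - q' z) f = kernelForm ν K q f - kernelForm ν K q' f := by
  rw [kernelForm, kernelForm, kernelForm,
    ← integral_sub (integrable_conj_mul_kernel hν hσ hK hC hf hq)
      (integrable_conj_mul_kernel hν hσ hK hC hf hq')]
  refine integral_congr_ae (Eventually.of_forall fun y => ?_)
  simp only [map_sub, sub_mul]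

theorem kernelForm_sub_right (hν : ∀ᵐ z ∂ν, z ∈ σ) (hσ : MeasurableSet σ)
    (hK : ContinuousOn (Function.uncurry K) (σ ×ˢ σ)) (hC : ∀ x ∈ σ, ∀ y ∈ σ, ‖K x y‖ ≤ C)
    (hf : Integrable f ν) (hf' : Integrable f' ν) (hq : Integrable q ν) :
    kernelForm ν K q (fun z => f z - f' z) = kernelForm ν K q f - kernelForm ν K q f' := by
  rw [kernelForm, kernelForm, kernelForm,
    ← integral_sub (integrable_conj_mul_kernel hν hσ hK hC hf hq)
      (integrable_conj_mul_kernel hν hσ hK hC hf' hq)]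
  refine integral_congr_ae ?_
  filter_upwards [hν] with y hy
  rw [← mul_sub, ← integral_sub (integrable_kernel hν hσ hK hC hf hy)
    (integrable_kernel hν hσ hK hC hf' hy)]
  simp only [mul_sub]

/-- Continuity of the sesquilinear form with kernel `K` for the `L¹`-seminorm. -/
theorem tendsto_kernelForm (hν : ∀ᵐ z ∂ν, z ∈ σ) (hσ : MeasurableSet σ)
    (hK : ContinuousOn (Function.uncurry K) (σ ×ˢ σ)) (hC : ∀ x ∈ σ, ∀ y ∈ σ, ‖K x y‖ ≤ C)
    {q f : ℂ → ℂ} {qs fs : ℕ → ℂ → ℂ} (hq : Integrable q ν) (hf : Integrable f ν)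
    (hqs : ∀ k, Integrable (qs k) ν) (hfs : ∀ k, Integrable (fs k) ν)
    (hqlim : Tendsto (fun k => ∫ z, ‖qs k z - q z‖ ∂ν) atTop (𝓝 0))
    (hflim : Tendsto (fun k => ∫ z, ‖fs k z - f z‖ ∂ν) atTop (𝓝 0)) :
    Tendsto (fun k => kernelForm ν K (qs k) (fs k)) atTop (𝓝 (kernelForm ν K q f)) := by
  -- Expansion around `(q, f)`: two terms with one small argument and one with both small.
  have e : ∀ k, kernelForm ν K (qs k) (fs k) =
      kernelForm ν K q f + kernelForm ν K (fun z => qs k z - q z) f +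
        kernelForm ν K q (fun z => fs k z - f z) +
          kernelForm ν K (fun z => qs k z - q z) (fun z => fs k z - f z) := by
    intro k
    rw [kernelForm_sub_right hν hσ hK hC (hfs k) hf
        (q := fun z => qs k z - q z) ((hqs k).sub hq),
      kernelForm_sub_right hν hσ hK hC (hfs k) hf hq,
      kernelForm_sub_left hν hσ hK hC (hfs k) (hqs k) hq,
      kernelForm_sub_left hν hσ hK hC hf (hqs k) hq]
    ring
  have h1 : Tendsto (fun k => kernelForm ν K (fun z => qs k z - q z) f) atTop (𝓝 0) := by
    refine squeeze_zero_norm (fun k => norm_kernelForm_le hν hC hf ((hqs k).sub hq)) ?_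
    simpa using hqlim.mul_const (C * ∫ x, ‖f x‖ ∂ν)
  have h2 : Tendsto (fun k => kernelForm ν K q (fun z => fs k z - f z)) atTop (𝓝 0) := by
    refine squeeze_zero_norm (fun k => norm_kernelForm_le hν hC ((hfs k).sub hf) hq) ?_
    simpa using (hflim.const_mul C).const_mul (∫ x, ‖q x‖ ∂ν)
  have h3 : Tendsto (fun k => kernelForm ν K (fun z => qs k z - q z)
      (fun z => fs k z - f z)) atTop (𝓝 0) := by
    refine squeeze_zero_norm
      (fun k => norm_kernelForm_le hν hC ((hfs k).sub hf) ((hqs k).sub hq)) ?_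
    simpa using hqlim.mul (hflim.const_mul C)
  simp only [e]
  simpa using ((tendsto_const_nhds.add h1).add h2).add h3

/-- If `K` is close to `k₀` on a product of two sets, the form on their indicator functions is
close to `k₀` times the product of their measures. -/
theorem norm_kernelForm_indicator_sub_le [IsFiniteMeasure ν] (hν : ∀ᵐ z ∂ν, z ∈ σ)
    (hσ : MeasurableSet σ)
    (hK : ContinuousOn (Function.uncurry K) (σ ×ˢ σ)) (hC : ∀ x ∈ σ, ∀ y ∈ σ, ‖K x y‖ ≤ C)
    {S T : Set ℂ} (hS : MeasurableSet S) (hT : MeasurableSet T) {k₀ : ℂ} {ε : ℝ}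
    (h : ∀ x ∈ σ ∩ S, ∀ y ∈ σ ∩ T, ‖K x y - k₀‖ ≤ ε) :
    ‖kernelForm ν K (T.indicator fun _ => 1) (S.indicator fun _ => 1) -
      (ν.real T : ℂ) * (ν.real S : ℂ) * k₀‖ ≤ ν.real T * (ε * ν.real S) := by
  have hSi : Integrable (S.indicator fun _ => (1 : ℂ)) ν := (integrable_const 1).indicator hS
  have hTi : Integrable (T.indicator fun _ => (1 : ℂ)) ν := (integrable_const 1).indicator hT
  have int1 : ∀ {R : Set ℂ}, MeasurableSet R →
      ∫ z, R.indicator (fun _ => (1 : ℂ)) z ∂ν = (ν.real R : ℂ) := fun hR => by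
    rw [integral_indicator_const _ hR, Complex.real_smul, mul_one]
  have int2 : ∀ {R : Set ℂ}, MeasurableSet R →
      ∫ z, R.indicator (fun _ => (1 : ℝ)) z ∂ν = ν.real R := fun hR => by
    rw [integral_indicator_const _ hR, smul_eq_mul, mul_one]
  have inner : ∀ y ∈ σ ∩ T, ‖(∫ x, K x y * S.indicator (fun _ => (1 : ℂ)) x ∂ν) -
      (ν.real S : ℂ) * k₀‖ ≤ ε * ν.real S := by
    intro y hy
    rw [← int1 hS, ← integral_mul_const, ← integral_sub
      (integrable_kernel hν hσ hK hC hSi hy.1) (hSi.mul_const k₀), ← int2 hS,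
      ← integral_const_mul]
    refine norm_integral_le_of_norm_le
      (((integrable_const (1 : ℝ)).indicator hS).const_mul ε) ?_
    filter_upwards [hν] with x hx
    by_cases hxS : x ∈ S
    · simpa [hxS] using h x ⟨hx, hxS⟩ y hy
    · simp [hxS]
  rw [kernelForm, mul_assoc, ← int1 hT, ← integral_mul_const, ← integral_sub
    (integrable_conj_mul_kernel hν hσ hK hC hSi hTi) (hTi.mul_const _), ← int2 hT,
    ← integral_mul_const]
  refine norm_integral_le_of_norm_le (((integrable_const (1 : ℝ)).indicator hT).mul_const _) ?_
  filter_upwards [hν] with y hy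
  by_cases hyT : y ∈ T
  · simpa [hyT] using inner y ⟨hy, hyT⟩
  · simp [hyT]

end KernelForm

/-! ### Boxes of the grids. -/

section Grid

variable {H : Type*} [NormedAddCommGroup H] [InnerProductSpace ℂ H] [CompleteSpace H]
  {A : H →L[ℂ] H} {φ : H} {r : ℝ} {D : Ultrafilter ℕ} {E : EigenSystem A φ r} {ν : Measure ℂ}
  {M : ℕ} {α β : ℂ} {s : ℕ → ℕ → ℝ}

theorem IsGrid.endpoint_mem (hs : IsGrid D E M α β s) {x : ℝ}
    (hx : ∃ i ≤ 2 ^ (0 + 2), s 0 i = x) (n : ℕ) : ∃ i ≤ 2 ^ (n + 2), s n i = x := by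
  induction n with
  | zero => exact hx
  | succ n ih =>
    obtain ⟨i, hi, rfl⟩ := ih
    obtain ⟨j, hj, h⟩ := hs.refines n i hi
    exact ⟨j, hj, h.symm⟩

theorem IsGrid.mono (hs : IsGrid D E M α β s) (n : ℕ) {i j : ℕ} (hij : i ≤ j)
    (hj : j ≤ 2 ^ (n + 2)) : s n i ≤ s n j := by
  induction j, hij using Nat.le_induction with
  | base => exact le_rfl
  | succ k hk ih => exact (ih (by omega)).trans (hs.lt n k (by omega)).le

/-- The value `-M` of the coarsest grid survives in every refinement at some index; monotonicity and
the bound `-M` force it to be the first one. -/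
theorem IsGrid.first (hs : IsGrid D E M α β s) (n : ℕ) : s n 0 = -M := by
  obtain ⟨i, hi, h⟩ := hs.endpoint_mem ⟨0, by simp, hs.left⟩ n
  exact le_antisymm (h ▸ hs.mono n i.zero_le hi) (hs.mem n 0 (Nat.zero_le _)).1

theorem IsGrid.last (hs : IsGrid D E M α β s) (n : ℕ) : s n (2 ^ (n + 2)) = M := by
  obtain ⟨i, hi, h⟩ := hs.endpoint_mem ⟨4, by simp, hs.right⟩ n
  exact le_antisymm (hs.mem n _ le_rfl).2 (h ▸ hs.mono n hi le_rfl)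

/-- A number in `(-M, M)` that avoids the lines of the `n`-th grid is in one of the intervals. -/
theorem IsGrid.exists_interval (hs : IsGrid D E M α β s) (n : ℕ) {x : ℝ}
    (hx : x ∈ Set.Ioo (-M : ℝ) M) (hx' : ∀ i ≤ 2 ^ (n + 2), s n i ≠ x) :
    ∃ i < 2 ^ (n + 2), x ∈ Set.Ioo (s n i) (s n (i + 1)) := by
  by_contra! h
  have key : ∀ i ≤ 2 ^ (n + 2), s n i < x := by
    intro i
    induction i with
    | zero => intro _; rw [hs.first n]; exact hx.1
    | succ i ih =>
      intro hi
      refine lt_of_le_of_ne (not_lt.1 fun hlt => ?_) (hx' _ hi)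
      exact h i (by omega) ⟨ih (by omega), hlt⟩
  have := key _ le_rfl
  rw [hs.last n] at this
  exact absurd hx.2 (not_lt.2 this.le)

theorem IsGrid.interval_unique (hs : IsGrid D E M α β s) (n : ℕ) {x : ℝ} {i j : ℕ}
    (hi : i < 2 ^ (n + 2)) (hj : j < 2 ^ (n + 2)) (hxi : x ∈ Set.Ioo (s n i) (s n (i + 1)))
    (hxj : x ∈ Set.Ioo (s n j) (s n (j + 1))) : i = j := by
  rcases lt_trichotomy i j with h | h | h
  · have := hs.mono n (Nat.succ_le_of_lt h) hj.le
    linarith [hxi.2, hxj.1]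
  · exact h
  · have := hs.mono n (Nat.succ_le_of_lt h) hi.le
    linarith [hxi.1, hxj.2]

/-- The box that contains `z` is a grid box, for a point `z` that avoids the grid lines. -/
theorem IsGrid.exists_boxAt_eq (hs : IsGrid D E M α β s) (n : ℕ) {z : ℂ} (hz : ‖z‖ < M)
    (hz' : ∀ i ≤ 2 ^ (n + 2), s n i ≠ z.re ∧ s n i ≠ z.im) :
    ∃ i < 2 ^ (n + 2), ∃ j < 2 ^ (n + 2), z ∈ gridBox M s n i j ∧
      boxAt M s n z = gridBox M s n i j := by
  have hre : z.re ∈ Set.Ioo (-M : ℝ) M := abs_lt.1 ((Complex.abs_re_le_norm z).trans_lt hz)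
  have him : z.im ∈ Set.Ioo (-M : ℝ) M := abs_lt.1 ((Complex.abs_im_le_norm z).trans_lt hz)
  obtain ⟨i, hi, h1⟩ := hs.exists_interval n hre fun i hi => (hz' i hi).1
  obtain ⟨j, hj, h2⟩ := hs.exists_interval n him fun i hi => (hz' i hi).2
  have hmem : z ∈ gridBox M s n i j := ⟨⟨⟨hre.1.le, hre.2.le⟩, ⟨him.1.le, him.2.le⟩⟩, h1, h2⟩
  refine ⟨i, hi, j, hj, hmem, Set.Subset.antisymm ?_ fun w hw => ⟨i, hi, j, hj, hmem, hw⟩⟩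
  rintro w ⟨i', hi', j', hj', ⟨-, h3, h4⟩, hw⟩
  rwa [hs.interval_unique n hi' hi h3 h1, hs.interval_unique n hj' hj h4 h2] at hw

theorem IsGrid.null_re (hs : IsGrid D E M α β s) (hν : IsLimitMeasure D E ν) (hM : √r < M)
    {n i : ℕ} (hi : i ≤ 2 ^ (n + 2)) : ν {z | z.re = s n i} = 0 := by
  refine hν.null_re hM fun δ hδ => ?_
  obtain ⟨ε, hε, h⟩ := hs.small n δ hδ
  refine ⟨ε, hε, (muNaive_mono D E fun z hz => ?_).trans_lt h⟩
  exact Set.mem_biUnion (show i ∈ Set.Iic _ from hi) (Or.inl hz)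

theorem IsGrid.null_im (hs : IsGrid D E M α β s) (hν : IsLimitMeasure D E ν) (hM : √r < M)
    {n i : ℕ} (hi : i ≤ 2 ^ (n + 2)) : ν {z | z.im = s n i} = 0 := by
  refine hν.null_im hM fun δ hδ => ?_
  obtain ⟨ε, hε, h⟩ := hs.small n δ hδ
  refine ⟨ε, hε, (muNaive_mono D E fun z hz => ?_).trans_lt h⟩
  exact Set.mem_biUnion (show i ∈ Set.Iic _ from hi) (Or.inr hz)

/-- The properties of the box that contains `z` which the averaging argument needs. -/
theorem IsGrid.boxAt_spec (hs : IsGrid D E M α β s) (hν : IsLimitMeasure D E ν) (hM : √r < M)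
    (n : ℕ) {z : ℂ} (hz : ‖z‖ < M) (hz' : ∀ i ≤ 2 ^ (n + 2), s n i ≠ z.re ∧ s n i ≠ z.im) :
    IsOpen (boxAt M s n z) ∧ z ∈ boxAt M s n z ∧
      ν (boxAt M s n z) = ENNReal.ofReal (muNaive D E (boxAt M s n z)) ∧
      ∀ w ∈ boxAt M s n z, ‖w - z‖ ≤ 4 * M / (n + 1) := by
  obtain ⟨i, hi, j, hj, hmem, heq⟩ := hs.exists_boxAt_eq n hz hz'
  rw [heq]
  have m := fun k (hk : k ≤ 2 ^ (n + 2)) => hs.mem n k hk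
  refine ⟨isOpen_openRect (m _ hi.le) (m _ hi) (m _ hj.le) (m _ hj), hmem,
    hν.openRect_eq (m _ hi.le) (m _ hi) (m _ hj.le) (m _ hj) (hs.null_re hν hM hi.le)
      (hs.null_re hν hM hi) (hs.null_im hν hM hj.le) (hs.null_im hν hM hj), fun w hw => ?_⟩
  have g1 := hs.gap n i hi
  have g2 := hs.gap n j hj
  obtain ⟨-, ⟨a1, a2⟩, ⟨a3, a4⟩⟩ := hw
  obtain ⟨-, ⟨b1, b2⟩, ⟨b3, b4⟩⟩ := hmem
  have h1 : |(w - z).re| ≤ 2 * M / (n + 1) := by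
    rw [Complex.sub_re]
    exact abs_le.2 ⟨by linarith, by linarith⟩
  have h2 : |(w - z).im| ≤ 2 * M / (n + 1) := by
    rw [Complex.sub_im]
    exact abs_le.2 ⟨by linarith, by linarith⟩
  -- Each coordinate contributes one mesh width, by `‖w‖ ≤ |w.re| + |w.im|`.
  have h3 : 4 * (M : ℝ) / (n + 1) = 2 * M / (n + 1) + 2 * M / (n + 1) := by ring
  linarith [Complex.norm_le_abs_re_add_abs_im (w - z)]

end Grid

/-! ### Matrix coefficients in the ultraproduct. -/

section Limit

variable {H : Type*} [NormedAddCommGroup H] [InnerProductSpace ℂ H] [CompleteSpace H]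
  {A : H →L[ℂ] H} {φ : H} {r : ℝ} {D : Ultrafilter ℕ} {E : EigenSystem A φ r} {ν : Measure ℂ}

/-- The hypothesis concerns only the first vector because the second will be `B (P(A, A*) φ)`, which
need not lie in any `H_N`. -/
theorem inner_embedding {ψ ψ' : H} (h : ∀ᶠ N in (D : Filter ℕ), ψ ∈ subN A φ N) :
    inner ℂ (embedding A φ D ψ) (embedding A φ D ψ') = inner ℂ ψ ψ' := by
  refine tendsto_nhds_unique (inner_cls (projSeq A φ ψ) (projSeq A φ ψ') (projSeq_bdd A φ D ψ)
    (projSeq_bdd A φ D ψ')) (tendsto_const_nhds.congr' ?_)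
  filter_upwards [h] with N hN
  have e : projSeq A φ ψ N = ⟨ψ, hN⟩ :=
    Submodule.orthogonalProjectionOnto_mem_subspace_eq_self (K := subN A φ N) ⟨ψ, hN⟩
  rw [e]
  exact (Submodule.inner_orthogonalProjectionOnto_eq_of_mem_left (K := subN A φ N)
    ⟨ψ, hN⟩ ψ').symm

theorem norm_cls_sub_embedding_le {v : ∀ N, subN A φ N}
    (hv : v ∈ bddSubmodule D fun N => subN A φ N) {ψ : H} {δ : ℝ}
    (hψ : ∀ᶠ N in (D : Filter ℕ), ψ ∈ subN A φ N)
    (h : ∀ᶠ N in (D : Filter ℕ), ‖(v N : H) - ψ‖ < δ) :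
    ‖cls v hv - embedding A φ D ψ‖ ≤ δ := by
  have hs := sub_mem hv (projSeq_bdd A φ D ψ)
  have e : cls v hv - embedding A φ D ψ = cls (v - projSeq A φ ψ) hs :=
    ((SeparationQuotient.mkCLM ℂ (BddSeq D fun N => subN A φ N)).map_sub _ _).symm
  rw [e]
  refine le_of_tendsto (norm_cls _ hs) ?_
  filter_upwards [hψ, h] with N hN h1
  have e2 : projSeq A φ ψ N = ⟨ψ, hN⟩ :=
    Submodule.orthogonalProjectionOnto_mem_subspace_eq_self (K := subN A φ N) ⟨ψ, hN⟩
  rw [Pi.sub_apply, e2]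
  exact h1.le

/-- The inner product of `Q(A, A*) φ` with the image of the class of `g` under the unitary
operator `L₂(σ(A), μ) → H`. -/
theorem IsLimitMeasure.inner_eq_of_isL2Image (hν : IsLimitMeasure D E ν)
    (hD : (D : Filter ℕ) ≤ atTop) (hr : 0 < r) (hA : star A * A = (r : ℂ) • (1 : H →L[ℂ] H))
    (hA' : A * star A = (r : ℂ) • (1 : H →L[ℂ] H)) {g : ℂ → ℂ} {ψ : H}
    (hg : IsL2Image A φ ν g ψ) (Q : MvPolynomial (Fin 2) ℂ) :
    inner ℂ (polyOp A Q φ) ψ = ∫ z, (starRingEnd ℂ) (polyFun Q z) * g z ∂ν := by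
  have := hν.prob
  rw [IsL2Image, Measure.restrict_eq_self_of_ae_mem (hν.ae_mem_spectrum hD hr hA hA')] at hg
  obtain ⟨hgm, hg⟩ := hg
  have hQ := continuous_polyFun Q
  obtain ⟨C, hC⟩ := hν.exists_bound hQ
  have hC0 : 0 ≤ C := by
    obtain ⟨z, hz⟩ := hC.exists
    exact (norm_nonneg _).trans hz
  have hgi : Integrable g ν := by
    obtain ⟨P, -, hP⟩ := hg 1 one_pos
    have h1 : MemLp (g - polyFun P) 2 ν :=
      ⟨hgm.sub (continuous_polyFun P).aestronglyMeasurable, hP.trans ENNReal.ofReal_lt_top⟩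
    have h2 := (h1.integrable one_le_two).add (hν.integrable (continuous_polyFun P))
    simpa using h2
  have hQg : Integrable (fun z => (starRingEnd ℂ) (polyFun Q z) * g z) ν := by
    refine hgi.bdd_mul (c := C) (by fun_prop : Continuous _).aestronglyMeasurable ?_
    filter_upwards [hC] with z hz
    rwa [RCLike.norm_conj]
  refine eq_of_norm_sub_le_zero (le_of_forall_pos_le_add fun ε hε => ?_)
  -- For polynomials the identity is `inner_eq_integral`. Replacing `(g, ψ)` by such a pair costs at
  -- most `‖polyOp A Q φ‖ * δ` on one side and `C * δ` on the other; the `+ 1` keeps the denominator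
  -- positive.
  obtain ⟨P, hP1, hP2⟩ := hg (ε / (‖polyOp A Q φ‖ + C + 1)) (by positivity)
  set δ := ε / (‖polyOp A Q φ‖ + C + 1) with hδ
  have hPc := continuous_polyFun P
  have e := hν.inner_eq_integral hD (hasSymbol_polyOp (E := E) hr hA hA' Q)
    (hasSymbol_polyOp (E := E) hr hA hA' P) hQ hPc
  have h1 : ‖inner ℂ (polyOp A Q φ) ψ - inner ℂ (polyOp A Q φ) (polyOp A P φ)‖ ≤
      ‖polyOp A Q φ‖ * δ := by
    rw [← inner_sub_right]
    exact (norm_inner_le_norm _ _).trans (mul_le_mul_of_nonneg_left hP1.le (norm_nonneg _))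
  have hL1 : ∫ z, ‖g z - polyFun P z‖ ∂ν ≤ δ := by
    have h2 : Integrable (g - polyFun P) ν := hgi.sub (hν.integrable hPc)
    have h3 := integral_norm_eq_lintegral_enorm h2.aestronglyMeasurable
    -- On a probability space the `L²` norm dominates the `L¹` norm.
    have h4 : eLpNorm (g - polyFun P) 1 ν ≤ ENNReal.ofReal δ :=
      (eLpNorm_le_eLpNorm_of_exponent_le one_le_two h2.aestronglyMeasurable).trans hP2.le
    rw [eLpNorm_one_eq_lintegral_enorm] at h4
    exact h3.trans_le (ENNReal.toReal_le_of_le_ofReal (by positivity) h4)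
  have h2 : ‖(∫ z, (starRingEnd ℂ) (polyFun Q z) * g z ∂ν) -
      inner ℂ (polyOp A Q φ) (polyOp A P φ)‖ ≤ C * δ := by
    rw [e, ← integral_sub hQg (hν.integrable (by fun_prop))]
    refine (norm_integral_le_of_norm_le (g := fun z => C * ‖g z - polyFun P z‖)
      ((hgi.sub (hν.integrable hPc)).norm.const_mul C) ?_).trans ?_
    · filter_upwards [hC] with z hz
      rw [← mul_sub, norm_mul, RCLike.norm_conj]
      exact mul_le_mul_of_nonneg_right hz (norm_nonneg _)
    · rw [integral_const_mul]
      exact mul_le_mul_of_nonneg_left hL1 hC0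
  have h3 : (‖polyOp A Q φ‖ + C + 1) * δ = ε := mul_div_cancel₀ _ (by positivity)
  have h4 := norm_sub_le_norm_sub_add_norm_sub (inner ℂ (polyOp A Q φ) ψ)
    (inner ℂ (polyOp A Q φ) (polyOp A P φ)) (∫ z, (starRingEnd ℂ) (polyFun Q z) * g z ∂ν)
  rw [norm_sub_rev (inner ℂ (polyOp A Q φ) (polyOp A P φ))] at h4
  have h5 : 0 < δ := by positivity
  nlinarith

/-- The matrix coefficients of the ultraproduct operator between window vectors are given by the
kernel. -/
theorem IsLimitMeasure.inner_window (hν : IsLimitMeasure D E ν)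
    (hD : (D : Filter ℕ) ≤ atTop) (hr : 0 < r) (hA : star A * A = (r : ℂ) • (1 : H →L[ℂ] H))
    (hA' : A * star A = (r : ℂ) • (1 : H →L[ℂ] H)) (hφ : ‖φ‖ = 1)
    {B : H →ₗ[ℂ] H} {K : ℂ → ℂ → ℂ} (hK : HasKernel A φ ν B K) {C : ℝ}
    (hC : ∀ x ∈ spectrum ℂ A, ∀ y ∈ spectrum ℂ A, ‖K x y‖ ≤ C)
    {BN : ∀ N, subN A φ N →ₗ[ℂ] subN A φ N}
    (C1 : ∃ KD : ℕ, ∀ N (v : subN A φ N), ‖BN N v‖ ≤ KD * ‖v‖)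
    (C2 : ∀ ψ : H, ultraOp BN C1 (embedding A φ D ψ) = embedding A φ D (B ψ))
    {S T : Set ℂ} (hS : IsOpen S) (hT : IsOpen T)
    (hνS : ν S = ENNReal.ofReal (muNaive D E S)) (hνT : ν T = ENNReal.ofReal (muNaive D E T)) :
    inner ℂ (cls (windowVec E T) (windowVec_mem_bdd E T D))
      (ultraOp BN C1 (cls (windowVec E S) (windowVec_mem_bdd E S D))) =
      kernelForm ν K (T.indicator fun _ => 1) (S.indicator fun _ => 1) := by
  have := hν.prob
  have hsp := hν.ae_mem_spectrum hD hr hA hA'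
  have hσ : MeasurableSet (spectrum ℂ A) := (spectrum.isClosed A).measurableSet
  have hev : ∀ P : MvPolynomial (Fin 2) ℂ, ∀ᶠ N in (D : Filter ℕ), polyOp A P φ ∈ subN A φ N :=
    fun P => (Filter.Eventually.filter_mono hD (hasSymbol_polyOp (E := E) hr hA hA' P)).mono
      fun _ h => h.1
  -- (C2) moves the ultraproduct operator back to `B` on `H`, where the kernel is available.
  have hform : ∀ P Q : MvPolynomial (Fin 2) ℂ,
      inner ℂ (embedding A φ D (polyOp A Q φ)) (ultraOp BN C1 (embedding A φ D (polyOp A P φ))) =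
        kernelForm ν K (polyFun Q) (polyFun P) := by
    intro P Q
    obtain ⟨g, -, hg, hgK⟩ := hK.2 P
    rw [C2, inner_embedding (hev Q), hν.inner_eq_of_isL2Image hD hr hA hA' hg Q, kernelForm]
    refine integral_congr_ae ?_
    filter_upwards [hsp] with y hy
    rw [hgK y hy, Measure.restrict_eq_self_of_ae_mem hsp]
  -- One sequence of polynomials serves both limits: in the ultraproduct for the vectors, in `L¹(ν)`
  -- for the functions.
  have hseq : ∀ {R : Set ℂ}, IsOpen R → ν R = ENNReal.ofReal (muNaive D E R) →
      ∃ P : ℕ → MvPolynomial (Fin 2) ℂ,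
        Tendsto (fun k => embedding A φ D (polyOp A (P k) φ)) atTop
          (𝓝 (cls (windowVec E R) (windowVec_mem_bdd E R D))) ∧
        Tendsto (fun k => ∫ z, ‖polyFun (P k) z - R.indicator (fun _ => (1 : ℂ)) z‖ ∂ν) atTop
          (𝓝 0) := by
    intro R hR hνR
    choose P hP1 hP2 using fun k : ℕ => hν.exists_poly_window hD hr hA hA' hφ hR hνR
      (Nat.one_div_pos_of_nat (α := ℝ) (n := k))
    refine ⟨P, ?_, squeeze_zero (fun _ => integral_nonneg fun _ => norm_nonneg _)
      (fun k => (hP2 k).le) tendsto_one_div_add_atTop_nhds_zero_nat⟩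
    rw [tendsto_iff_norm_sub_tendsto_zero]
    refine squeeze_zero (fun _ => norm_nonneg _) (fun k => ?_)
      tendsto_one_div_add_atTop_nhds_zero_nat
    rw [norm_sub_rev]
    exact norm_cls_sub_embedding_le _ (hev _) (hP1 k)
  obtain ⟨P, hP1, hP2⟩ := hseq hS hνS
  obtain ⟨Q, hQ1, hQ2⟩ := hseq hT hνT
  have hlim := hQ1.inner (𝕜 := ℂ) (((ultraOp BN C1).continuous.tendsto _).comp hP1)
  refine tendsto_nhds_unique hlim ((tendsto_kernelForm hsp hσ hK.1 hC
    ((integrable_const (1 : ℂ)).indicator hT.measurableSet)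
    ((integrable_const (1 : ℂ)).indicator hS.measurableSet)
    (fun k => hν.integrable (continuous_polyFun (Q k)))
    (fun k => hν.integrable (continuous_polyFun (P k))) hQ2 hP2).congr fun k => ?_)
  exact (hform (P k) (Q k)).symm

end Limit

end KernelLimit

/-! ### The mean of the kernel over shrinking boxes. -/

open Filter Topology KernelLimit in
theorem theorem5p2 {H : Type*} [NormedAddCommGroup H] [InnerProductSpace ℂ H] [CompleteSpace H]
    [TopologicalSpace.SeparableSpace H]
    (A : H →L[ℂ] H) (r : ℝ) (hr : 0 < r)
    (hA : star A * A = (r : ℂ) • (1 : H →L[ℂ] H)) (hA' : A * star A = (r : ℂ) • (1 : H →L[ℂ] H))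
    (φ : H) (hφ : ‖φ‖ = 1) (hcyc : IsCyclicVector A φ)
    (E : EigenSystem A φ r)
    (M : ℕ) (hM : ‖A‖ < M) (hM' : √r < M)
    (D : Ultrafilter ℕ)
    (hD : ∀ m : ℕ, m ≠ 0 → {N : ℕ | N ≠ 0 ∧ ∃ k : ℕ, k ^ 2 = N ∧ m ∣ k} ∈ D)
    (NI : NiceSet D E M)
    (B : H →ₗ[ℂ] H) (K : ℂ → ℂ → ℂ) (hK : HasKernel A φ (spectralMeasure NI) B K)
    (BN : ∀ N, subN A φ N →ₗ[ℂ] subN A φ N)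
    (C1 : ∃ KD : ℕ, ∀ N (v : subN A φ N), ‖BN N v‖ ≤ KD * ‖v‖)
    (C2 : ∀ ψ : H, ultraOp BN C1 (embedding A φ D ψ) = embedding A φ D (B ψ))
    (α β : ℂ) (hα : α ∈ spectrum ℂ A) (hβ : β ∈ spectrum ℂ A)
    (s : ℕ → ℕ → ℝ) (hs : IsGrid D E M α β s) :
    ∃ (uα : ∀ p, averageVec E M s p α ∈ bddSubmodule D fun N => subN A φ N)
      (uβ : ∀ p, averageVec E M s p β ∈ bddSubmodule D fun N => subN A φ N),
      Tendsto
        (fun p => inner ℂ (cls (averageVec E M s p β) (uβ p))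
          (ultraOp BN C1 (cls (averageVec E M s p α) (uα p))))
        atTop (𝓝 (K α β)) := by
  have hDtop : (D : Filter ℕ) ≤ atTop := by
    refine tendsto_atTop.2 fun m => ?_
    -- A nonzero `k ^ 2` with `m + 1 ∣ k` is at least `k ≥ m + 1`.
    filter_upwards [hD (m + 1) m.succ_ne_zero] with N hN
    obtain ⟨hN0, k, rfl, hk⟩ := hN
    have hk0 : 0 < k := Nat.pos_of_ne_zero fun h => hN0 (by simp [h])
    have := Nat.le_of_dvd hk0 hk
    exact (Nat.le_of_succ_le this).trans (Nat.le_self_pow two_ne_zero k)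
  obtain ⟨ν, hν⟩ := exists_isLimitMeasure (E := E) (fun N n => norm_lam hr hA n) hφ D
  rw [hν.eq_spectralMeasure hM' hφ NI] at hK
  have := hν.prob
  have hsp := hν.ae_mem_spectrum hDtop hr hA hA'
  have hσ : MeasurableSet (spectrum ℂ A) := (spectrum.isClosed A).measurableSet
  -- Bounding the spectrum by `‖A‖` uses `‖1‖ = 1` for operators on `H`, so `H` must not be trivial.
  have : Nontrivial H := ⟨⟨φ, 0, fun h => by simp [h] at hφ⟩⟩
  obtain ⟨C, hC⟩ :=
    ((spectrum.isCompact A).prod (spectrum.isCompact A)).exists_bound_of_continuousOn hK.1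
  have hC' : ∀ x ∈ spectrum ℂ A, ∀ y ∈ spectrum ℂ A, ‖K x y‖ ≤ C :=
    fun x hx y hy => hC (x, y) ⟨hx, hy⟩
  have hnorm : ∀ z ∈ spectrum ℂ A, ‖z‖ < M := fun z hz =>
    (spectrum.norm_le_norm_of_mem hz).trans_lt hM
  have bα := fun p => hs.boxAt_spec hν hM' p (hnorm α hα) fun i hi =>
    ⟨(hs.avoid p i hi).1, (hs.avoid p i hi).2.1⟩
  have bβ := fun p => hs.boxAt_spec hν hM' p (hnorm β hβ) fun i hi =>
    ⟨(hs.avoid p i hi).2.2.1, (hs.avoid p i hi).2.2.2⟩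
  have hpos : ∀ z ∈ spectrum ℂ A, ∀ U, IsOpen U → z ∈ U → 0 < ν U := by
    intro z hz U hU hzU
    obtain ⟨ε, hε, hsub⟩ := Metric.isOpen_iff.1 hU z hzU
    exact (pos_iff_ne_zero.2 (hν.ball_ne_zero hDtop hr hA hA' hcyc hz hε)).trans_le
      (measure_mono hsub)
  have hαpos : ∀ p, 0 < muNaive D E (boxAt M s p α) := fun p => by
    have := hpos α hα _ (bα p).1 (bα p).2.1
    rwa [(bα p).2.2.1, ENNReal.ofReal_pos] at this
  have hβpos : ∀ p, 0 < muNaive D E (boxAt M s p β) := fun p => by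
    have := hpos β hβ _ (bβ p).1 (bβ p).2.1
    rwa [(bβ p).2.2.1, ENNReal.ofReal_pos] at this
  choose uα huα using fun p => averageVec_cls (D := D) (E := E) M s p α (hαpos p).ne'
  choose uβ huβ using fun p => averageVec_cls (D := D) (E := E) M s p β (hβpos p).ne'
  refine ⟨uα, uβ, ?_⟩
  have hreal : ∀ {S : Set ℂ}, ν S = ENNReal.ofReal (muNaive D E S) →
      ν.real S = muNaive D E S := fun h => by
    rw [Measure.real, h, ENNReal.toReal_ofReal (muNaive_nonneg D E _)]
  rw [Metric.tendsto_atTop]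
  intro ε hε
  have hKc := hK.1 (α, β) ⟨hα, hβ⟩
  obtain ⟨δ, hδ, hKδ⟩ := Metric.continuousWithinAt_iff.1 hKc (ε / 2) (half_pos hε)
  have hmesh : Tendsto (fun p : ℕ => 4 * (M : ℝ) / (p + 1)) atTop (𝓝 0) := by
    have := (tendsto_one_div_add_atTop_nhds_zero_nat (𝕜 := ℝ)).const_mul (4 * (M : ℝ))
    simpa [div_eq_mul_inv] using this
  obtain ⟨p₀, hp₀⟩ := eventually_atTop.1 (hmesh.eventually_lt_const hδ)
  refine ⟨p₀, fun p hp => ?_⟩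
  have hlt := hp₀ p hp
  rw [huα, huβ, map_smul, inner_smul_left, inner_smul_right, Complex.conj_ofReal,
    hν.inner_window hDtop hr hA hA' hφ hK hC' C1 C2 (bα p).1 (bβ p).1 (bα p).2.2.1 (bβ p).2.2.1]
  -- Once the mesh is below `δ`, `K` is within `ε / 2` of `K α β` on the spectral part of the
  -- product of the boxes; dividing by the product of their measures leaves an error of at most `ε /
  -- 2`.
  have hclose := norm_kernelForm_indicator_sub_le (ν := ν) hsp hσ hK.1 hC'
    (bα p).1.measurableSet (bβ p).1.measurableSet (k₀ := K α β) (ε := ε / 2) (by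
      rintro x ⟨hx, hxS⟩ y ⟨hy, hyT⟩
      rw [← dist_eq_norm]
      refine (hKδ (x := (x, y)) ⟨hx, hy⟩ ?_).le
      rw [Prod.dist_eq, dist_eq_norm, dist_eq_norm]
      exact max_lt (((bα p).2.2.2 x hxS).trans_lt hlt) (((bβ p).2.2.2 y hyT).trans_lt hlt))
  rw [hreal (bα p).2.2.1, hreal (bβ p).2.2.1] at hclose
  set a := muNaive D E (boxAt M s p α)
  set b := muNaive D E (boxAt M s p β)
  have ha : 0 < a := hαpos p
  have hb : 0 < b := hβpos p
  set k := kernelForm ν K ((boxAt M s p β).indicator fun _ => 1)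
    ((boxAt M s p α).indicator fun _ => 1)
  have hac : (a : ℂ) ≠ 0 := by exact_mod_cast ha.ne'
  have hbc : (b : ℂ) ≠ 0 := by exact_mod_cast hb.ne'
  have e : ((b⁻¹ : ℝ) : ℂ) * (((a⁻¹ : ℝ) : ℂ) * k) - K α β =
      (((b * a)⁻¹ : ℝ) : ℂ) * (k - (b : ℂ) * (a : ℂ) * K α β) := by
    push_cast
    field_simp
  rw [dist_eq_norm, e, norm_mul, Complex.norm_real, Real.norm_of_nonneg (by positivity),
    inv_mul_lt_iff₀ (by positivity)]
  refine hclose.trans_lt ?_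
  have := mul_pos hb ha
  nlinarith
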